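/- Let $\mathbb{X},\mathbb{Y},\mathbb{Z}$ be finite-dimensional real Hilbert spaces, $f_1:\mathbb{Y}\to(-\infty,+\infty]$ and $f_2:\mathbb{Z}\to(-\infty,+\infty]$ proper closed convex functions, $B_1:\mathbb{Y}\to\mathbb{X}$ and $B_2:\mathbb{Z}\to\mathbb{X}$ linear operators, and $c\in\mathbb{X}$. Consider the primal problem $$\min_{y\in\mathbb{Y},\,z\in\mathbb{Z}}\ f_1(y)+f_2(z)\quad\text{s.t.}\quad B_1y+B_2z=c,$$ and its dual $$\max_{x\in\mathbb{X}}\ \{-f_1^*(-B_1^*x)-f_2^*(-B_2^*x)-\langle c,x\rangle\}.$$ Let $T_1,T_2$ be self-adjoint positive semidefinite linear operators on $\mathbb{Y}$ and $\mathbb{Z}$, and write $\|u\|_T^2=\langle u,Tu\rangle$. Let $\Sigma_{f_1},\Sigma_{f_2}$ be self-adjoint positive semidefinite linear operators on $\mathbb{Y}$ and $\mathbb{Z}$ such that, for $i=1,2$, $$f_i(u)\ \ge\ f_i(\hat u)+\langle v,u-\hat u\rangle+\tfrac12\|u-\hat u\|_{\Sigma_{f_i}}^2\qquad\text{for all }u,\hat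 u\in\operatorname{dom}(f_i),\ v\in\partial f_i(\hat u).$$ Let $\sigma>0$, $\rho\in(0,2]$ and $w^0=(y^0,z^0,x^0)\in\operatorname{dom}(f_1)\times\operatorname{dom}(f_2)\times\mathbb{X}$. The semi-proximal (preconditioned) ADMM generates, for $k=0,1,\dots$, the points $w^k=(y^k,z^k,x^k)$ and $\bar w^k=(\bar y^k,\bar z^k,\bar x^k)$ by $$\bar z^k=\operatorname*{arg\,min}_{z\in\mathbb{Z}}\ \Big\{f_2(z)+\langle x^k,B_1y^k+B_2z-c\rangle+\tfrac{\sigma}{2}\|B_1y^k+B_2z-c\|^2+\tfrac12\|z-z^k\|_{T_2}^2\Big\},$$ $$\bar x^k=x^k+\sigma(B_1y^k+B_2\bar z^k-c),$$ $$\bar y^k=\operatorname*{arg\,min}_{y\in\mathbb{Y}}\ \Big\{f_1(y)+\langle \bar x^k,B_1y+B_2\bar z^k-c\rangle+\tfrac{\sigma}{2}\|B_1y+B_2\bar z^k-c\|^2+\tfrac12\|y-y^k\|_{T_1}^2\Big\},$$ $$w^{k+1}=(1-\rho)w^k+\rho\,\bar w^k.$$ (The case $\rho=2$ is the Peaceman–Rachford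 method with semi-proximal terms.) Assume that the KKT system $$-B_1^*x\in\partial f_1(y),\qquad -B_2^*x\in\partial f_2(z),\qquad B_1y+B_2z-c=0$$ has at least one solution $(y,z,x)$, and that $\Sigma_{f_i}+B_i^*B_i+T_i$ is positive definite for $i=1,2$. Then the algorithm is well defined, i.e. it generates exactly one pair of sequences $\{w^k\}$, $\{\bar w^k\}$ from $w^0$, and the ergodic sequence $$\bar w_a^k=(\bar y_a^k,\bar z_a^k,\bar x_a^k)=\frac1{k+1}\sum_{t=0}^k(\bar y^t,\bar z^t,\bar x^t)$$ converges, as $k\to\infty$, to a point $(y^*,z^*,x^*)$ such that $(y^*,z^*)$ is an optimal solution of the primal problem and $x^*$ is an optimal solution of the dual problem. -/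

import Mathlib

open Filter Topology
open scoped InnerProductSpace

noncomputable section

namespace ErgodicPADMM

section Functions

variable {E : Type*} [NormedAddCommGroup E] [InnerProductSpace ℝ E]

/-- The effective domain of an extended-real-valued function. -/
def dom (f : E → EReal) : Set E := {x | f x < ⊤}

/-- `f : E → (-∞, +∞]` is a proper closed convex function: it never takes the value `-∞`, it is not
identically `+∞`, it is lower semicontinuous, and its epigraph is convex. -/
structure IsProperClosedConvex (f : E → EReal) : Prop where
  ne_bot : ∀ x, f x ≠ ⊥
  dom_nonempty : (dom f).Nonempty
  closed : LowerSemicontinuous f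
  convex : Convex ℝ {p : E × ℝ | f p.1 ≤ (p.2 : EReal)}

/-- The convex conjugate `f^*(x) = sup_z {⟪x, z⟫ - f z}`. -/
def conjugate (f : E → EReal) (x : E) : EReal := ⨆ z : E, ((⟪x, z⟫_ℝ : ℝ) : EReal) - f z

/-- The subdifferential `∂f(x) = {v | f z ≥ f x + ⟪v, z - x⟫ for all z}`. -/
def subdifferential (f : E → EReal) (x : E) : Set E :=
  {v | ∀ z, f x + ((⟪v, z - x⟫_ℝ : ℝ) : EReal) ≤ f z}

/-- The squared semi-norm `‖x‖_T² = ⟪x, T x⟫`. -/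
def seminormSq (T : E →ₗ[ℝ] E) (x : E) : ℝ := ⟪x, T x⟫_ℝ

/-- Self-adjoint positive definite operators (positive semidefinite self-adjoint operators are
`LinearMap.IsPositive`). -/
def IsPosDef (T : E →ₗ[ℝ] E) : Prop := T.IsSymmetric ∧ ∀ x, x ≠ 0 → 0 < ⟪x, T x⟫_ℝ

/-- `S` is an admissible choice of the operator `Σ_f`: it is self-adjoint positive semidefinite and
`f x ≥ f x' + ⟪v, x - x'⟫ + (1/2) ‖x - x'‖_S²` for all `x, x' ∈ dom f` and `v ∈ ∂f(x')`. -/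
def IsConvexityOperator (f : E → EReal) (S : E →ₗ[ℝ] E) : Prop :=
  S.IsPositive ∧ ∀ x ∈ dom f, ∀ x' ∈ dom f, ∀ v ∈ subdifferential f x',
    f x' + ((⟪v, x - x'⟫_ℝ + 1 / 2 * seminormSq S (x - x') : ℝ) : EReal) ≤ f x

end Functions

/-- The data of the problem `min {f₁ y + f₂ z | B₁ y + B₂ z = c}`. -/
structure COP (Y Z X : Type*)
    [NormedAddCommGroup Y] [InnerProductSpace ℝ Y]
    [NormedAddCommGroup Z] [InnerProductSpace ℝ Z]
    [NormedAddCommGroup X] [InnerProductSpace ℝ X] where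
  f₁ : Y → EReal
  f₂ : Z → EReal
  B₁ : Y →ₗ[ℝ] X
  B₂ : Z →ₗ[ℝ] X
  c : X

namespace COP

variable {Y Z X : Type*}
  [NormedAddCommGroup Y] [InnerProductSpace ℝ Y]
  [NormedAddCommGroup Z] [InnerProductSpace ℝ Z]
  [NormedAddCommGroup X] [InnerProductSpace ℝ X]

/-- The constraint residual `B₁ y + B₂ z - c`. -/
def residual (P : COP Y Z X) (y : Y) (z : Z) : X := P.B₁ y + P.B₂ z - P.c

/-- `(y, z)` is an optimal solution of `min {f₁ y + f₂ z | B₁ y + B₂ z = c}`. -/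
def IsPrimalSolution (P : COP Y Z X) (y : Y) (z : Z) : Prop :=
  y ∈ dom P.f₁ ∧ z ∈ dom P.f₂ ∧ P.B₁ y + P.B₂ z = P.c ∧
    ∀ y' z', P.B₁ y' + P.B₂ z' = P.c → P.f₁ y + P.f₂ z ≤ P.f₁ y' + P.f₂ z'

/-- The finite part `⟪x, B₁ y + B₂ z - c⟫ + (σ/2) ‖B₁ y + B₂ z - c‖²` of the augmented
Lagrangian. -/
def augTerm (P : COP Y Z X) (σ : ℝ) (y : Y) (z : Z) (x : X) : ℝ :=
  ⟪x, P.residual y z⟫_ℝ + σ / 2 * ‖P.residual y z‖ ^ 2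

/-- The augmented Lagrangian `L_σ(y, z; x)`. -/
def augLagrangian (P : COP Y Z X) (σ : ℝ) (y : Y) (z : Z) (x : X) : EReal :=
  P.f₁ y + P.f₂ z + (P.augTerm σ y z x : EReal)

/-- The objective, as a function of `u`, of the `z`-subproblem
`argmin_u {L_σ(y, u; x) + (1/2) ‖u - z‖_{T₂}²}` without the summand `f₁ y`. That summand does not
depend on `u`; it has to be left out because the over-relaxed iterate `y` may lie outside `dom f₁`
when `ρ > 1`. -/
def zObjective (P : COP Y Z X) (T₂ : Z →ₗ[ℝ] Z) (σ : ℝ) (y : Y) (z : Z) (x : X) (u : Z) : EReal :=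
  P.f₂ u + ((P.augTerm σ y u x + 1 / 2 * seminormSq T₂ (u - z) : ℝ) : EReal)

/-- The objective, as a function of `u`, of the `y`-subproblem
`argmin_u {L_σ(u, z; x) + (1/2) ‖u - y‖_{T₁}²}` without the summand `f₂ z`, which does not depend
on `u`. -/
def yObjective (P : COP Y Z X) (T₁ : Y →ₗ[ℝ] Y) (σ : ℝ) (y : Y) (z : Z) (x : X) (u : Y) : EReal :=
  P.f₁ u + ((P.augTerm σ u z x + 1 / 2 * seminormSq T₁ (u - y) : ℝ) : EReal)

/-- The objective of the `z`-subproblem really is `L_σ(y, u; x) + (1/2) ‖u - z‖_{T₂}²` up to the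
constant `f₁ y`. -/
theorem augLagrangian_add_eq_zObjective (P : COP Y Z X) (T₂ : Z →ₗ[ℝ] Z) (σ : ℝ) (y : Y) (z : Z)
    (x : X) (u : Z) :
    P.augLagrangian σ y u x + ((1 / 2 * seminormSq T₂ (u - z) : ℝ) : EReal) =
      P.f₁ y + P.zObjective T₂ σ y z x u := by
  simp only [augLagrangian, zObjective, EReal.coe_add, add_assoc]

/-- The objective of the `y`-subproblem really is `L_σ(u, z; x) + (1/2) ‖u - y‖_{T₁}²` up to the
constant `f₂ z`. -/
theorem augLagrangian_add_eq_yObjective (P : COP Y Z X) (T₁ : Y →ₗ[ℝ] Y) (σ : ℝ) (y : Y) (z : Z)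
    (x : X) (u : Y) :
    P.augLagrangian σ u z x + ((1 / 2 * seminormSq T₁ (u - y) : ℝ) : EReal) =
      P.f₂ z + P.yObjective T₁ σ y z x u := by
  simp only [augLagrangian, yObjective, EReal.coe_add, add_assoc, add_left_comm]

/-- One pass of the method from `w = (y, z, x)`: `wb = (ȳ, z̄, x̄)` satisfies
`z̄ = argmin_u {L_σ(y, u; x) + (1/2) ‖u - z‖_{T₂}²}`, `x̄ = x + σ (B₁ y + B₂ z̄ - c)` and
`ȳ = argmin_u {L_σ(u, z̄; x̄) + (1/2) ‖u - y‖_{T₁}²}`. -/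
def IsPADMMStep (P : COP Y Z X) (T₁ : Y →ₗ[ℝ] Y) (T₂ : Z →ₗ[ℝ] Z) (σ : ℝ) (w wb : Y × Z × X) :
    Prop :=
  IsMinOn (P.zObjective T₂ σ w.1 w.2.1 w.2.2) Set.univ wb.2.1 ∧
  wb.2.2 = w.2.2 + σ • P.residual w.1 wb.2.1 ∧
  IsMinOn (P.yObjective T₁ σ w.1 wb.2.1 wb.2.2) Set.univ wb.1

/-- The sequences `w^k = (y^k, z^k, x^k)` and `wb^k = (ȳ^k, z̄^k, x̄^k)` are generated by the
preconditioned ADMM with relaxation factor `ρ`, started at `w0`. -/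
def IsPADMM (P : COP Y Z X) (T₁ : Y →ₗ[ℝ] Y) (T₂ : Z →ₗ[ℝ] Z) (σ ρ : ℝ) (w0 : Y × Z × X)
    (w wb : ℕ → Y × Z × X) : Prop :=
  w 0 = w0 ∧ ∀ k, P.IsPADMMStep T₁ T₂ σ (w k) (wb k) ∧
    w (k + 1) = (1 - ρ) • w k + ρ • wb k

variable [FiniteDimensional ℝ Y] [FiniteDimensional ℝ Z] [FiniteDimensional ℝ X]

/-- The dual objective `-f₁^*(-B₁^* x) - f₂^*(-B₂^* x) - ⟪c, x⟫`. -/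
def dualObjective (P : COP Y Z X) (x : X) : EReal :=
  - conjugate P.f₁ (-(P.B₁.adjoint x)) - conjugate P.f₂ (-(P.B₂.adjoint x))
    - ((⟪P.c, x⟫_ℝ : ℝ) : EReal)

/-- `x` is an optimal solution of the dual problem: it is dual feasible (the dual objective is not
`-∞` there) and it maximizes the dual objective. -/
def IsDualSolution (P : COP Y Z X) (x : X) : Prop :=
  P.dualObjective x ≠ ⊥ ∧ ∀ x', P.dualObjective x' ≤ P.dualObjective x

/-- `(y, z, x)` solves the KKT system
`-B₁^* x ∈ ∂f₁(y)`, `-B₂^* x ∈ ∂f₂(z)`, `B₁ y + B₂ z - c = 0`. -/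
def IsKKT (P : COP Y Z X) (y : Y) (z : Z) (x : X) : Prop :=
  -(P.B₁.adjoint x) ∈ subdifferential P.f₁ y ∧ -(P.B₂.adjoint x) ∈ subdifferential P.f₂ z ∧
    P.B₁ y + P.B₂ z - P.c = 0

end COP

/-- The ergodic sequence `(1 / (k + 1)) ∑_{t=0}^{k} s^t`. -/
def ergodicMean {V : Type*} [AddCommGroup V] [Module ℝ V] (s : ℕ → V) (k : ℕ) : V :=
  (1 / ((k : ℝ) + 1)) • ∑ t ∈ Finset.range (k + 1), s t

end ErgodicPADMM

end

/-! The method is a relaxed proximal point iteration for the KKT inclusion in the semi-inner product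
`proxForm`, written m. The optimality conditions of a step bound the Lagrangian gap between `wb` and
any `v` with finite objective by -m(wb - w, wb - v) (`gap_le`). By `relaxed_step_form`, 2ρ times
this bound telescopes whenever ρ ≤ 2. For ρ = 2 nothing controls wb - w, so only averages can be
expected to converge.

Three consequences follow. Summing and applying Jensen's inequality gives an ergodic gap of order
1/k, so ergodic cluster points are saddle points (`isKKT_of_cluster`). At a KKT point `v` the bound
is nonnegative, so m(w - v, w - v) decreases, and despite the degeneracy of m the `wb` stay bounded
(`exists_norm_le`). Finally, for KKT points v₁, v₂, polarization shows that m(v₁ - v₂, ·) converges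
along `w`, hence along `wb` and its means. Two cluster points thus have m-distance zero and
coincide, because m separates KKT points (`eq_of_proxForm_eq_zero`). -/

namespace ErgodicPADMM

/-! ### Convex analysis: subgradients, and minimization of convex plus quadratic functions. -/

section Functions

variable {E : Type*} [NormedAddCommGroup E] [InnerProductSpace ℝ E] {f : E → EReal}

theorem IsProperClosedConvex.coe_toReal (hf : IsProperClosedConvex f) {x : E} (hx : x ∈ dom f) :
    ((f x).toReal : EReal) = f x :=
  EReal.coe_toReal (ne_of_lt hx) (hf.ne_bot x)

theorem IsProperClosedConvex.mem_dom_of_mem_subdifferential (hf : IsProperClosedConvex f)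
    {x v : E} (hv : v ∈ subdifferential f x) : x ∈ dom f := by
  obtain ⟨z, hz⟩ := hf.dom_nonempty
  have h := hv z
  by_contra hx
  rw [show f x = ⊤ from not_lt_top_iff.1 hx, EReal.top_add_coe] at h
  exact absurd hz (not_lt.2 h)

/-- Passage to real arithmetic. The restriction to `dom f` matters: `toReal` sends `⊤` to 0, whereas
the extended inequality is trivial there. -/
theorem IsProperClosedConvex.mem_subdifferential_iff (hf : IsProperClosedConvex f) {x v : E}
    (hx : x ∈ dom f) :
    v ∈ subdifferential f x ↔
      ∀ z ∈ dom f, (f x).toReal + ⟪v, z - x⟫_ℝ ≤ (f z).toReal := by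
  refine forall_congr' fun z => ?_
  by_cases hz : z ∈ dom f
  · rw [← hf.coe_toReal hx, ← hf.coe_toReal hz]
    simp only [hz, true_imp_iff, EReal.toReal_coe]
    exact_mod_cast Iff.rfl
  · simp [hz, show f z = ⊤ from not_lt_top_iff.1 hz]

theorem IsConvexityOperator.toReal_add_le {S : E →ₗ[ℝ] E} (hS : IsConvexityOperator f S)
    (hf : IsProperClosedConvex f) {x x' v : E} (hx : x ∈ dom f)
    (hv : v ∈ subdifferential f x') :
    (f x').toReal + (⟪v, x - x'⟫_ℝ + 1 / 2 * seminormSq S (x - x')) ≤ (f x).toReal := by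
  have hx' := hf.mem_dom_of_mem_subdifferential hv
  have h := hS.2 x hx x' hx' v hv
  rw [← hf.coe_toReal hx, ← hf.coe_toReal hx'] at h
  exact_mod_cast h

theorem seminormSq_neg (T : E →ₗ[ℝ] E) (x : E) : seminormSq T (-x) = seminormSq T x := by
  simp [seminormSq]

theorem seminormSq_sub_comm (T : E →ₗ[ℝ] E) (x y : E) :
    seminormSq T (x - y) = seminormSq T (y - x) := by
  rw [← neg_sub, seminormSq_neg]

theorem seminormSq_nonneg {T : E →ₗ[ℝ] E} (hT : T.IsPositive) (x : E) : 0 ≤ seminormSq T x := by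
  have h := hT.2 x
  simp only [RCLike.re_to_real] at h
  rwa [real_inner_comm] at h

theorem IsConvexityOperator.strongly_monotone {S : E →ₗ[ℝ] E} (hS : IsConvexityOperator f S)
    (hf : IsProperClosedConvex f) {x x' v v' : E} (hv : v ∈ subdifferential f x)
    (hv' : v' ∈ subdifferential f x') :
    seminormSq S (x - x') ≤ ⟪v - v', x - x'⟫_ℝ := by
  have h1 := hS.toReal_add_le hf (hf.mem_dom_of_mem_subdifferential hv) hv'
  have h2 := hS.toReal_add_le hf (hf.mem_dom_of_mem_subdifferential hv') hv
  rw [seminormSq_sub_comm S x' x, ← neg_sub x x', inner_neg_right] at h2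
  rw [inner_sub_left]
  linarith

/-- `q` is a quadratic function with Hessian `H` and gradient `G`. -/
def IsQuadratic (q : E → ℝ) (H : E →ₗ[ℝ] E) (G : E → E) : Prop :=
  ∀ u v, q u = q v + ⟪G v, u - v⟫_ℝ + 1 / 2 * seminormSq H (u - v)

theorem IsProperClosedConvex.toReal_combo_le (hf : IsProperClosedConvex f) {x y : E}
    (hx : x ∈ dom f) (hy : y ∈ dom f) {t : ℝ} (h0 : 0 ≤ t) (h1 : t ≤ 1) :
    x + t • (y - x) ∈ dom f ∧
      (f (x + t • (y - x))).toReal ≤ (f x).toReal + t * ((f y).toReal - (f x).toReal) := by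
  have h := hf.convex (x := (x, (f x).toReal)) (by simp [hf.coe_toReal hx])
    (y := (y, (f y).toReal)) (by simp [hf.coe_toReal hy]) (sub_nonneg.2 h1) h0 (by ring)
  have e : (1 - t) • x + t • y = x + t • (y - x) := by module
  simp only [Prod.smul_mk, Prod.mk_add_mk, smul_eq_mul, Set.mem_ofPred_eq, e] at h
  have hd : x + t • (y - x) ∈ dom f := lt_of_le_of_lt h (EReal.coe_lt_top _)
  refine ⟨hd, ?_⟩
  rw [← hf.coe_toReal hd, EReal.coe_le_coe_iff] at h
  linarith

theorem IsProperClosedConvex.isMinOn_add_iff (hf : IsProperClosedConvex f) {q : E → ℝ}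
    {ub : E} (hub : ub ∈ dom f) :
    IsMinOn (fun u => f u + (q u : EReal)) Set.univ ub ↔
      ∀ u ∈ dom f, (f ub).toReal + q ub ≤ (f u).toReal + q u := by
  simp only [isMinOn_iff, Set.mem_univ, true_imp_iff]
  refine forall_congr' fun z => ?_
  by_cases hz : z ∈ dom f
  · rw [← hf.coe_toReal hub, ← hf.coe_toReal hz]
    simp only [hz, true_imp_iff, EReal.toReal_coe]
    exact_mod_cast Iff.rfl
  · simp [hz, show f z = ⊤ from not_lt_top_iff.1 hz]

theorem IsProperClosedConvex.mem_dom_of_isMinOn (hf : IsProperClosedConvex f) {q : E → ℝ}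
    {ub : E} (h : IsMinOn (fun u => f u + (q u : EReal)) Set.univ ub) : ub ∈ dom f := by
  obtain ⟨z, hz⟩ := hf.dom_nonempty
  have h := isMinOn_iff.1 h z (Set.mem_univ z)
  by_contra hx
  rw [show f ub = ⊤ from not_lt_top_iff.1 hx, EReal.top_add_coe, ← hf.coe_toReal hz] at h
  exact absurd h (not_le.2 (by rw [← EReal.coe_add]; exact EReal.coe_lt_top _))

/-- The first-order optimality condition for a convex function plus a quadratic. -/
theorem IsProperClosedConvex.neg_mem_subdifferential_of_isMinOn (hf : IsProperClosedConvex f)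
    {q : E → ℝ} {H : E →ₗ[ℝ] E} {G : E → E} (hq : IsQuadratic q H G) {ub : E}
    (h : IsMinOn (fun u => f u + (q u : EReal)) Set.univ ub) : -G ub ∈ subdifferential f ub := by
  have hub := hf.mem_dom_of_isMinOn h
  rw [hf.isMinOn_add_iff hub] at h
  rw [hf.mem_subdifferential_iff hub]
  intro z hz
  rw [inner_neg_left]
  set a := (f z).toReal - (f ub).toReal + ⟪G ub, z - ub⟫_ℝ with ha
  set b := 1 / 2 * seminormSq H (z - ub) with hb
  -- Compare `ub` with the point at parameter `t` on the segment to `z`: convexity of `f` and the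
  -- expansion of `q` give t(a + tb) ≥ 0. Divide by `t`, then let `t` tend to 0.
  have key : ∀ t ∈ Set.Ioo (0 : ℝ) 1, 0 ≤ a + t * b := by
    intro t ht
    obtain ⟨hd, hle⟩ := hf.toReal_combo_le hub hz ht.1.le ht.2.le
    have h1 := h _ hd
    rw [hq (ub + t • (z - ub)) ub, add_sub_cancel_left, inner_smul_right] at h1
    have e : seminormSq H (t • (z - ub)) = t ^ 2 * seminormSq H (z - ub) := by
      simp only [seminormSq, map_smul, inner_smul_left, inner_smul_right, RCLike.conj_to_real]
      ring
    rw [e] at h1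
    have : 0 ≤ t * (a + t * b) := by rw [ha, hb]; nlinarith
    exact nonneg_of_mul_nonneg_right this ht.1
  have hlim : Tendsto (fun t : ℝ => a + t * b) (𝓝[>] 0) (𝓝 (a + 0 * b)) :=
    Tendsto.mono_left (Continuous.tendsto (by fun_prop) 0) nhdsWithin_le_nhds
  have : 0 ≤ a + 0 * b := ge_of_tendsto hlim (by
    filter_upwards [Ioo_mem_nhdsGT (zero_lt_one (α := ℝ))] with t ht using key t ht)
  linarith

/-- Compactness of the unit sphere, which is empty only when the space is trivial. -/
theorem exists_pos_mul_norm_sq_le [FiniteDimensional ℝ E] {A : E →ₗ[ℝ] E}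
    (hA : ∀ x, x ≠ 0 → 0 < ⟪x, A x⟫_ℝ) : ∃ m > 0, ∀ x, m * ‖x‖ ^ 2 ≤ ⟪x, A x⟫_ℝ := by
  have hc : Continuous fun x => ⟪x, A x⟫_ℝ :=
    continuous_id.inner (LinearMap.continuous_of_finiteDimensional A)
  rcases (Metric.sphere (0 : E) 1).eq_empty_or_nonempty with he | hne
  · refine ⟨1, one_pos, fun x => ?_⟩
    have : x = 0 := by
      by_contra hx
      have : (‖x‖⁻¹ • x) ∈ Metric.sphere (0 : E) 1 := by
        simp [norm_smul, norm_ne_zero_iff.2 hx]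
      simp [he] at this
    simp [this]
  · obtain ⟨x0, hx0, hmin⟩ := (isCompact_sphere (0 : E) 1).exists_isMinOn hne hc.continuousOn
    have hx0' : x0 ≠ 0 := by
      rintro rfl
      simp at hx0
    refine ⟨_, hA x0 hx0', fun x => ?_⟩
    by_cases hx : x = 0
    · simp [hx]
    have hn : ‖x‖ ≠ 0 := norm_ne_zero_iff.2 hx
    have h := isMinOn_iff.1 hmin (‖x‖⁻¹ • x) (by simp [norm_smul, hn])
    simp only [map_smul, inner_smul_left, inner_smul_right, RCLike.conj_to_real] at h
    calc _ ≤ ‖x‖⁻¹ * (‖x‖⁻¹ * ⟪x, A x⟫_ℝ) * ‖x‖ ^ 2 := by gcongr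
      _ = _ := by field_simp

/-- A convex function plus a quadratic, which together are strongly convex, has exactly one
minimizer. -/
theorem IsProperClosedConvex.existsUnique_isMinOn [FiniteDimensional ℝ E]
    (hf : IsProperClosedConvex f) {S : E →ₗ[ℝ] E} (hS : IsConvexityOperator f S)
    {x0 v0 : E} (hv0 : v0 ∈ subdifferential f x0)
    {q : E → ℝ} {H : E →ₗ[ℝ] E} {G : E → E} (hq : IsQuadratic q H G) (hqc : Continuous q)
    (hpos : ∀ x, x ≠ 0 → 0 < ⟪x, (S + H) x⟫_ℝ) :
    ∃! u, IsMinOn (fun u => f u + (q u : EReal)) Set.univ u := by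
  have hadd : ∀ x, ⟪x, (S + H) x⟫_ℝ = seminormSq S x + seminormSq H x := fun x => by
    simp [seminormSq, inner_add_right]
  have hgrow : ∀ {x v}, v ∈ subdifferential f x → ∀ u ∈ dom f,
      (f x).toReal + q x + ⟪v + G x, u - x⟫_ℝ + 1 / 2 * ⟪u - x, (S + H) (u - x)⟫_ℝ ≤
        (f u).toReal + q u := by
    intro x v hv u hu
    have h := hS.toReal_add_le hf hu hv
    rw [hq u x, hadd, inner_add_left]
    linarith
  obtain ⟨m, hm, hmle⟩ := exists_pos_mul_norm_sq_le hpos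
  have hx0 := hf.mem_dom_of_mem_subdifferential hv0
  set p := v0 + G x0
  -- Outside this radius (m/2)r² outweighs ‖p‖r, so no value falls below the one at `x0`; minimizing
  -- over the compact ball suffices.
  set R := 2 * ‖p‖ / m with hR
  have hlsc : LowerSemicontinuous fun u => f u + (q u : EReal) := by
    refine hf.closed.add' (continuous_coe_real_ereal.comp hqc).lowerSemicontinuous fun x => ?_
    exact EReal.continuousAt_add (Or.inr (EReal.coe_ne_bot _)) (Or.inr (EReal.coe_ne_top _))
  have hR0 : 0 ≤ R := by positivity
  obtain ⟨u, hu, humin⟩ := (hlsc.lowerSemicontinuousOn _).exists_isMinOn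
    (s := Metric.closedBall x0 R) ⟨x0, Metric.mem_closedBall_self hR0⟩ (isCompact_closedBall x0 R)
  rw [isMinOn_iff] at humin
  have hmin0 := humin x0 (Metric.mem_closedBall_self hR0)
  have hmin : IsMinOn (fun u => f u + (q u : EReal)) Set.univ u := by
    rw [isMinOn_iff]
    intro z _
    by_cases hz : z ∈ Metric.closedBall x0 R
    · exact humin z hz
    refine hmin0.trans ?_
    by_cases hzd : z ∈ dom f
    · rw [← hf.coe_toReal hx0, ← hf.coe_toReal hzd]
      norm_cast
      have h := hgrow hv0 z hzd
      have h1 := hmle (z - x0)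
      have h2 := neg_le_of_abs_le (abs_real_inner_le_norm p (z - x0))
      rw [Metric.mem_closedBall, dist_eq_norm, not_le, hR, div_lt_iff₀ hm] at hz
      nlinarith [norm_nonneg (z - x0)]
    · simp [show f z = ⊤ from not_lt_top_iff.1 hzd]
  refine ⟨u, hmin, fun u' hmin' => ?_⟩
  -- At a minimizer the subgradient cancels the gradient of `q`, leaving pure quadratic growth,
  -- which excludes a second minimizer.
  have hsub := hf.neg_mem_subdifferential_of_isMinOn hq hmin
  have hud' := hf.mem_dom_of_isMinOn hmin'
  have h := hgrow hsub u' hud'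
  rw [neg_add_cancel, inner_zero_left] at h
  have h' := (hf.isMinOn_add_iff hud').1 hmin' u (hf.mem_dom_of_isMinOn hmin)
  by_contra hne
  have := hpos (u' - u) (sub_ne_zero.2 hne)
  linarith

theorem isQuadratic_augmented {F : Type*} [NormedAddCommGroup F] [InnerProductSpace ℝ F]
    [FiniteDimensional ℝ E] [FiniteDimensional ℝ F] (B : E →ₗ[ℝ] F) {T : E →ₗ[ℝ] E}
    (hT : T.IsPositive) (σ : ℝ) (x e : F) (z : E) :
    IsQuadratic (fun u => ⟪x, B u + e⟫_ℝ + σ / 2 * ‖B u + e‖ ^ 2 + 1 / 2 * seminormSq T (u - z))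
      (σ • (B.adjoint ∘ₗ B) + T) (fun u => B.adjoint (x + σ • (B u + e)) + T (u - z)) := by
  intro u v
  obtain ⟨d, rfl⟩ : ∃ d, u = v + d := ⟨u - v, by abel⟩
  have e1 : ⟪e, B d⟫_ℝ = ⟪B d, e⟫_ℝ := real_inner_comm _ _
  have e2 : v + d - z = (v - z) + d := by abel
  have e3 : ⟪v - z, T d⟫_ℝ = ⟪T (v - z), d⟫_ℝ := (hT.isSymmetric (v - z) d).symm
  have e4 : ⟪d, T (v - z)⟫_ℝ = ⟪T (v - z), d⟫_ℝ := real_inner_comm _ _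
  simp only [e1, e2, add_sub_cancel_left, norm_add_sq_real, seminormSq, map_add, inner_add_left,
    inner_add_right, LinearMap.add_apply, LinearMap.smul_apply, LinearMap.comp_apply,
    inner_smul_left, inner_smul_right, LinearMap.adjoint_inner_left, LinearMap.adjoint_inner_right,
    RCLike.conj_to_real, real_inner_self_eq_norm_sq, e3, e4, map_smul]
  ring

/-- The factor σ is harmless: either B x = 0 and it plays no role, or σ‖B x‖² is already positive.
-/
theorem posDef_add_smul_of_posDef {F : Type*} [NormedAddCommGroup F] [InnerProductSpace ℝ F]
    [FiniteDimensional ℝ E] [FiniteDimensional ℝ F] {B : E →ₗ[ℝ] F} {S T : E →ₗ[ℝ] E}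
    (hS : S.IsPositive) (hT : T.IsPositive) (h : IsPosDef (S + B.adjoint ∘ₗ B + T)) {σ : ℝ}
    (hσ : 0 < σ) (x : E) (hx : x ≠ 0) : 0 < ⟪x, (S + (σ • (B.adjoint ∘ₗ B) + T)) x⟫_ℝ := by
  have h := h.2 x hx
  have h1 := seminormSq_nonneg hS x
  have h2 := seminormSq_nonneg hT x
  simp only [seminormSq, LinearMap.add_apply, LinearMap.smul_apply, LinearMap.comp_apply,
    inner_add_right, inner_smul_right, LinearMap.adjoint_inner_right,
    real_inner_self_eq_norm_sq] at *
  rcases (sq_nonneg ‖B x‖).eq_or_lt with h3 | h3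
  · rw [← h3] at h ⊢
    linarith
  · have := mul_pos hσ h3
    linarith

end Functions

/-! ### Ergodic means and abstract ergodic convergence. -/

section Ergodic

variable {V : Type*} [NormedAddCommGroup V] [NormedSpace ℝ V]

theorem ergodicMean_map {W : Type*} [AddCommGroup W] [Module ℝ W] (φ : V →ₗ[ℝ] W) (s : ℕ → V)
    (k : ℕ) : φ (ergodicMean s k) = ergodicMean (fun t => φ (s t)) k := by
  simp [ergodicMean, map_sum]

theorem norm_ergodicMean_le {s : ℕ → V} {C : ℝ} (hC : ∀ k, ‖s k‖ ≤ C) (k : ℕ) :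
    ‖ergodicMean s k‖ ≤ C := by
  have hk : (0 : ℝ) < k + 1 := by positivity
  have h : ‖∑ t ∈ Finset.range (k + 1), s t‖ ≤ (k + 1) * C := by
    simpa using norm_sum_le_of_le (Finset.range (k + 1)) fun t _ => hC t
  rw [ergodicMean, norm_smul, Real.norm_of_nonneg (by positivity), one_div, inv_mul_le_iff₀ hk]
  exact h

theorem tendsto_ergodicMean {s : ℕ → ℝ} {l : ℝ} (h : Tendsto s atTop (𝓝 l)) :
    Tendsto (ergodicMean s) atTop (𝓝 l) := by
  refine (h.cesaro.comp (tendsto_add_atTop_nat 1)).congr fun k => ?_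
  simp [ergodicMean]

/-- Expand the square of (w - v) + ρ(wb - w) and write w - v = (wb - v) - (wb - w). The last
coefficient is what limits ρ to at most 2. -/
theorem relaxed_step_form (m : V →ₗ[ℝ] V →ₗ[ℝ] ℝ) (hsymm : ∀ a b, m a b = m b a) (ρ : ℝ)
    (w wb v : V) :
    m ((1 - ρ) • w + ρ • wb - v) ((1 - ρ) • w + ρ • wb - v) =
      m (w - v) (w - v) + 2 * ρ * m (wb - w) (wb - v) - ρ * (2 - ρ) * m (wb - w) (wb - w) := by
  have h1 := hsymm w wb
  have h2 := hsymm v wb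
  have h3 := hsymm w v
  simp only [map_sub, map_add, map_smul, LinearMap.sub_apply, LinearMap.add_apply,
    LinearMap.smul_apply, smul_eq_mul, h1, h2, h3]
  ring

/-- Ergodic convergence for a relaxed, degenerate proximal point iteration: bounded iterates
whose ergodic cluster points lie in `F`, for a semi-inner product `m` that separates `F`. -/
theorem exists_tendsto_ergodicMean [FiniteDimensional ℝ V] (m : V →ₗ[ℝ] V →ₗ[ℝ] ℝ)
    (hsymm : ∀ a b, m a b = m b a) (hnonneg : ∀ a, 0 ≤ m a a) {ρ : ℝ} (hρ0 : 0 < ρ) {F : Set V}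
    {w wb : ℕ → V} (hw : ∀ k, w (k + 1) = (1 - ρ) • w k + ρ • wb k)
    (hanti : ∀ v ∈ F, Antitone fun k => m (w k - v) (w k - v))
    {C : ℝ} (hC : ∀ k, ‖wb k‖ ≤ C)
    (hcluster : ∀ (v : V) (φ : ℕ → ℕ), Tendsto φ atTop atTop →
      Tendsto (fun k => ergodicMean wb (φ k)) atTop (𝓝 v) → v ∈ F)
    (hsep : ∀ v₁ ∈ F, ∀ v₂ ∈ F, m (v₁ - v₂) (v₁ - v₂) = 0 → v₁ = v₂) :
    ∃ v ∈ F, Tendsto (ergodicMean wb) atTop (𝓝 v) := by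
  have hprop : ProperSpace V := FiniteDimensional.proper ℝ V
  have hball : ∀ k, ergodicMean wb k ∈ Metric.closedBall (0 : V) C := fun k => by
    simpa using norm_ergodicMean_le hC k
  have hlim : ∀ v ∈ F, ∃ l, Tendsto (fun k => m (w k - v) (w k - v)) atTop (𝓝 l) := fun v hv =>
    ⟨_, tendsto_atTop_ciInf (hanti v hv) ⟨0, by rintro _ ⟨k, rfl⟩; exact hnonneg _⟩⟩
  have hpair : ∀ v₁ ∈ F, ∀ v₂ ∈ F, ∃ l,
      Tendsto (fun k => m (v₁ - v₂) (ergodicMean wb k)) atTop (𝓝 l) := by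
    intro v₁ h₁ v₂ h₂
    obtain ⟨l₁, hl₁⟩ := hlim v₁ h₁
    obtain ⟨l₂, hl₂⟩ := hlim v₂ h₂
    -- Polarization: the difference of the two squared distances is affine in `w k`, since the
    -- quadratic terms cancel.
    have hwlim : ∃ l, Tendsto (fun k => m (v₁ - v₂) (w k)) atTop (𝓝 l) := by
      refine ⟨_, ((hl₂.sub hl₁).add_const (m v₁ v₁ - m v₂ v₂) |>.div_const 2).congr fun k => ?_⟩
      simp only [map_sub, LinearMap.sub_apply, hsymm (w k)]
      ring
    obtain ⟨l, hl⟩ := hwlim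
    -- The relaxation recurrence is solved for `wb k`; dividing by ρ requires ρ ≠ 0.
    have hwb : Tendsto (fun k => m (v₁ - v₂) (wb k)) atTop (𝓝 ((l - (1 - ρ) * l) / ρ)) := by
      refine (((hl.comp (tendsto_add_atTop_nat 1)).sub (hl.const_mul (1 - ρ))).div_const ρ).congr
        fun k => ?_
      simp only [Function.comp_apply, hw, map_add, map_smul, smul_eq_mul]
      field_simp
      ring
    exact ⟨_, (tendsto_ergodicMean hwb).congr fun k => (ergodicMean_map _ _ _).symm⟩
  obtain ⟨v, -, φ, hφ, hv⟩ := tendsto_subseq_of_bounded Metric.isBounded_closedBall hball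
  have hvF := hcluster v φ hφ.tendsto_atTop hv
  -- It remains to see that every subsequence has a further one with the same limit `v`. Any other
  -- limit `v'` gives m(v - v', ·) the same value `l` at both points.
  refine ⟨v, hvF, tendsto_of_subseq_tendsto fun ns hns => ?_⟩
  obtain ⟨v', -, ψ, hψ, hv'⟩ :=
    tendsto_subseq_of_bounded Metric.isBounded_closedBall fun k => hball (ns k)
  have hnψ := hns.comp hψ.tendsto_atTop
  have hvF' := hcluster v' _ hnψ hv'
  obtain ⟨l, hl⟩ := hpair v hvF v' hvF'
  have hcont : Continuous fun a => m (v - v') a :=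
    LinearMap.continuous_of_finiteDimensional (m (v - v'))
  have e1 : m (v - v') v = l :=
    tendsto_nhds_unique ((hcont.tendsto v).comp hv) (hl.comp hφ.tendsto_atTop)
  have e2 : m (v - v') v' = l :=
    tendsto_nhds_unique ((hcont.tendsto v').comp hv') (hl.comp hnψ)
  have : v = v' := hsep v hvF v' hvF' (by rw [map_sub (m (v - v')), e1, e2, sub_self])
  exact ⟨ψ, this ▸ hv'⟩

end Ergodic

/-! ### The semi-inner product of the method and well-posedness of its steps. -/

namespace COP

variable {Y Z X : Type*}
  [NormedAddCommGroup Y] [InnerProductSpace ℝ Y]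
  [NormedAddCommGroup Z] [InnerProductSpace ℝ Z]
  [NormedAddCommGroup X] [InnerProductSpace ℝ X]
  {P : COP Y Z X} {T₁ S₁ : Y →ₗ[ℝ] Y} {T₂ S₂ : Z →ₗ[ℝ] Z} {σ ρ : ℝ}

/-- The bilinear form of the degenerate proximal term of the preconditioned ADMM. -/
noncomputable def proxForm (P : COP Y Z X) (T₁ : Y →ₗ[ℝ] Y) (T₂ : Z →ₗ[ℝ] Z) (σ : ℝ) :
    (Y × Z × X) →ₗ[ℝ] (Y × Z × X) →ₗ[ℝ] ℝ :=
  LinearMap.mk₂ ℝ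
    (fun a b => ⟪a.1, T₁ b.1⟫_ℝ + ⟪a.2.1, T₂ b.2.1⟫_ℝ +
      σ * ⟪P.B₁ a.1 + σ⁻¹ • a.2.2, P.B₁ b.1 + σ⁻¹ • b.2.2⟫_ℝ)
    (fun a a' b => by
      simp only [Prod.fst_add, Prod.snd_add, map_add, smul_add, inner_add_left, inner_add_right]
      ring)
    (fun r a b => by
      simp only [Prod.smul_fst, Prod.smul_snd, map_smul, smul_comm σ⁻¹ r, ← smul_add,
        real_inner_smul_left, smul_eq_mul]
      ring)
    (fun a b b' => by
      simp only [Prod.fst_add, Prod.snd_add, map_add, smul_add, inner_add_left, inner_add_right]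
      ring)
    (fun r a b => by
      simp only [Prod.smul_fst, Prod.smul_snd, map_smul, smul_comm σ⁻¹ r, ← smul_add,
        real_inner_smul_right, smul_eq_mul]
      ring)

theorem proxForm_apply (a b : Y × Z × X) : P.proxForm T₁ T₂ σ a b =
    ⟪a.1, T₁ b.1⟫_ℝ + ⟪a.2.1, T₂ b.2.1⟫_ℝ +
      σ * ⟪P.B₁ a.1 + σ⁻¹ • a.2.2, P.B₁ b.1 + σ⁻¹ • b.2.2⟫_ℝ := rfl

theorem proxForm_self (a : Y × Z × X) : P.proxForm T₁ T₂ σ a a =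
    seminormSq T₁ a.1 + seminormSq T₂ a.2.1 + σ * ‖P.B₁ a.1 + σ⁻¹ • a.2.2‖ ^ 2 := by
  rw [proxForm_apply, real_inner_self_eq_norm_sq]
  rfl

theorem proxForm_symm (hT₁ : T₁.IsPositive) (hT₂ : T₂.IsPositive) (a b : Y × Z × X) :
    P.proxForm T₁ T₂ σ a b = P.proxForm T₁ T₂ σ b a := by
  rw [proxForm_apply, proxForm_apply, ← hT₁.isSymmetric, ← hT₂.isSymmetric, real_inner_comm,
    real_inner_comm b.2.1, real_inner_comm (P.B₁ b.1 + σ⁻¹ • b.2.2)]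

theorem proxForm_self_nonneg (hT₁ : T₁.IsPositive) (hT₂ : T₂.IsPositive) (hσ : 0 < σ)
    (a : Y × Z × X) : 0 ≤ P.proxForm T₁ T₂ σ a a := by
  rw [proxForm_self]
  have := seminormSq_nonneg hT₁ a.1
  have := seminormSq_nonneg hT₂ a.2.1
  positivity

theorem zObjective_eq (y : Y) (z : Z) (x : X) :
    P.zObjective T₂ σ y z x = fun u => P.f₂ u + ((⟪x, P.B₂ u + (P.B₁ y - P.c)⟫_ℝ +
      σ / 2 * ‖P.B₂ u + (P.B₁ y - P.c)‖ ^ 2 + 1 / 2 * seminormSq T₂ (u - z) : ℝ) : EReal) := by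
  funext u
  rw [zObjective, augTerm, residual, add_comm (P.B₁ y), add_sub_assoc]

theorem yObjective_eq (y : Y) (z : Z) (x : X) :
    P.yObjective T₁ σ y z x = fun u => P.f₁ u + ((⟪x, P.B₁ u + (P.B₂ z - P.c)⟫_ℝ +
      σ / 2 * ‖P.B₁ u + (P.B₂ z - P.c)‖ ^ 2 + 1 / 2 * seminormSq T₁ (u - y) : ℝ) : EReal) := by
  funext u
  rw [yObjective, augTerm, residual, add_sub_assoc]

/-- By the multiplier update, the residual after the step is exactly the third block of `proxForm`
at wb - w; this turns the optimality conditions into a proximal inclusion. -/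
theorem IsPADMMStep.residual_eq {w wb : Y × Z × X} (h : P.IsPADMMStep T₁ T₂ σ w wb) (hσ : 0 < σ) :
    P.residual wb.1 wb.2.1 = P.B₁ (wb - w).1 + σ⁻¹ • (wb - w).2.2 := by
  simp only [Prod.fst_sub, Prod.snd_sub, h.2.1, residual, add_sub_cancel_left,
    smul_smul, inv_mul_cancel₀ hσ.ne', one_smul, map_sub]
  abel

theorem continuous_augmented {E F : Type*} [NormedAddCommGroup E] [InnerProductSpace ℝ E]
    [NormedAddCommGroup F] [InnerProductSpace ℝ F] [FiniteDimensional ℝ E] (B : E →ₗ[ℝ] F)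
    (T : E →ₗ[ℝ] E) (σ : ℝ) (x e : F) (z : E) :
    Continuous fun u => ⟪x, B u + e⟫_ℝ + σ / 2 * ‖B u + e‖ ^ 2 + 1 / 2 * seminormSq T (u - z) := by
  have hB := LinearMap.continuous_of_finiteDimensional B
  have hT := LinearMap.continuous_of_finiteDimensional T
  unfold seminormSq
  fun_prop

theorem existsUnique_isPADMM (hstep : ∀ w, ∃! wb, P.IsPADMMStep T₁ T₂ σ w wb) (w0 : Y × Z × X) :
    ∃! s : (ℕ → Y × Z × X) × (ℕ → Y × Z × X), P.IsPADMM T₁ T₂ σ ρ w0 s.1 s.2 := by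
  choose g hg hgu using hstep
  set F : Y × Z × X → Y × Z × X := fun w => (1 - ρ) • w + ρ • g w with hF
  refine ⟨(fun k => F^[k] w0, fun k => g (F^[k] w0)),
    ⟨rfl, fun k => ⟨hg _, Function.iterate_succ_apply' F k w0⟩⟩, ?_⟩
  rintro ⟨w, wb⟩ ⟨h0, hs⟩
  have hwb : ∀ k, wb k = g (w k) := fun k => hgu _ _ (hs k).1
  have hw : ∀ k, w k = F^[k] w0 := by
    intro k
    induction k with
    | zero => exact h0
    | succ k ih =>
      have h1 : w (k + 1) = (1 - ρ) • w k + ρ • wb k := (hs k).2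
      rw [h1, hwb, ih, Function.iterate_succ_apply']
  refine Prod.ext (funext hw) (funext fun k => ?_)
  exact (hwb k).trans (congrArg g (hw k))

variable [FiniteDimensional ℝ Y] [FiniteDimensional ℝ Z] [FiniteDimensional ℝ X]

/-- The subproblems are solved in sequence. The KKT point only supplies a subgradient of each
function, which yields coercivity. -/
theorem existsUnique_isPADMMStep (hf₁ : IsProperClosedConvex P.f₁)
    (hf₂ : IsProperClosedConvex P.f₂) (hKKT : ∃ (y : Y) (z : Z) (x : X), P.IsKKT y z x)
    (hS₁ : IsConvexityOperator P.f₁ S₁) (hS₂ : IsConvexityOperator P.f₂ S₂)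
    (hT₁ : T₁.IsPositive) (hT₂ : T₂.IsPositive)
    (hpd₁ : IsPosDef (S₁ + P.B₁.adjoint ∘ₗ P.B₁ + T₁))
    (hpd₂ : IsPosDef (S₂ + P.B₂.adjoint ∘ₗ P.B₂ + T₂)) (hσ : 0 < σ) (w : Y × Z × X) :
    ∃! wb, P.IsPADMMStep T₁ T₂ σ w wb := by
  obtain ⟨y, z, x, hy, hz, -⟩ := hKKT
  have hexz : ∃! u, IsMinOn (P.zObjective T₂ σ w.1 w.2.1 w.2.2) Set.univ u := by
    rw [zObjective_eq]
    exact hf₂.existsUnique_isMinOn hS₂ hz (isQuadratic_augmented P.B₂ hT₂ _ _ _ _)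
      (continuous_augmented _ _ _ _ _ _) (posDef_add_smul_of_posDef hS₂.1 hT₂ hpd₂ hσ)
  obtain ⟨zb, hzb, hzu⟩ := hexz
  have hexy : ∃! u, IsMinOn (P.yObjective T₁ σ w.1 zb (w.2.2 + σ • P.residual w.1 zb))
      Set.univ u := by
    rw [yObjective_eq]
    exact hf₁.existsUnique_isMinOn hS₁ hy (isQuadratic_augmented P.B₁ hT₁ _ _ _ _)
      (continuous_augmented _ _ _ _ _ _) (posDef_add_smul_of_posDef hS₁.1 hT₁ hpd₁ hσ)
  obtain ⟨yb, hyb, hyu⟩ := hexy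
  refine ⟨(yb, zb, _), ⟨hzb, rfl, hyb⟩, ?_⟩
  rintro ⟨yb', zb', xb'⟩ ⟨h1, h2, h3⟩
  dsimp only at h1 h2 h3
  obtain rfl : zb' = zb := hzu _ h1
  subst h2
  obtain rfl : yb' = yb := hyu _ h3
  rfl

/-! ### Optimality conditions and Lagrangian gap of a single step. -/

namespace IsPADMMStep

variable {w wb : Y × Z × X}

-- The penalty gradient shifts the multiplier x to x + σ(B₁ y + B₂ z̄ - c), which is x̄ itself. In
-- the y-condition the analogous shift of x̄ remains visible.
omit [FiniteDimensional ℝ Y] in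
theorem subgradient₂ (h : P.IsPADMMStep T₁ T₂ σ w wb) (hf₂ : IsProperClosedConvex P.f₂)
    (hT₂ : T₂.IsPositive) :
    -(P.B₂.adjoint wb.2.2 + T₂ (wb.2.1 - w.2.1)) ∈ subdifferential P.f₂ wb.2.1 := by
  have h1 := h.1
  rw [zObjective_eq] at h1
  have h2 := hf₂.neg_mem_subdifferential_of_isMinOn (isQuadratic_augmented P.B₂ hT₂ _ _ _ _) h1
  convert h2 using 5
  rw [h.2.1, residual, add_comm (P.B₁ _), add_sub_assoc]

omit [FiniteDimensional ℝ Z] in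
theorem subgradient₁ (h : P.IsPADMMStep T₁ T₂ σ w wb) (hf₁ : IsProperClosedConvex P.f₁)
    (hT₁ : T₁.IsPositive) :
    -(P.B₁.adjoint (wb.2.2 + σ • P.residual wb.1 wb.2.1) + T₁ (wb.1 - w.1)) ∈
      subdifferential P.f₁ wb.1 := by
  have h1 := h.2.2
  rw [yObjective_eq] at h1
  have h2 := hf₁.neg_mem_subdifferential_of_isMinOn (isQuadratic_augmented P.B₁ hT₁ _ _ _ _) h1
  convert h2 using 5
  rw [residual, add_sub_assoc]

/-- The proximal term paired with `wb - v`, in terms of the optimality conditions. -/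
theorem proxForm_eq (h : P.IsPADMMStep T₁ T₂ σ w wb) (hT₁ : T₁.IsPositive)
    (hT₂ : T₂.IsPositive) (hσ : 0 < σ) (v : Y × Z × X) :
    P.proxForm T₁ T₂ σ (wb - w) (wb - v) =
      ⟪P.B₁.adjoint (wb.2.2 + σ • P.residual wb.1 wb.2.1) + T₁ (wb.1 - w.1), wb.1 - v.1⟫_ℝ +
      ⟪P.B₂.adjoint wb.2.2 + T₂ (wb.2.1 - w.2.1), wb.2.1 - v.2.1⟫_ℝ +
      ⟪wb.2.2, P.residual v.1 v.2.1⟫_ℝ - ⟪v.2.2, P.residual wb.1 wb.2.1⟫_ℝ := by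
  rw [proxForm_apply, ← h.residual_eq hσ]
  have e : P.B₁ (wb.1 - v.1) + P.B₂ (wb.2.1 - v.2.1) =
      P.residual wb.1 wb.2.1 - P.residual v.1 v.2.1 := by
    simp only [residual, map_sub]
    abel
  have e1 := congrArg (fun a => ⟪wb.2.2, a⟫_ℝ) e
  simp only [inner_add_right, inner_sub_right _ (P.residual _ _)] at e1
  rw [real_inner_comm (P.residual wb.1 wb.2.1) wb.2.2] at e1
  simp only [Prod.fst_sub, Prod.snd_sub, ← hT₁.isSymmetric (wb.1 - w.1),
    ← hT₂.isSymmetric (wb.2.1 - w.2.1), inner_add_left, LinearMap.adjoint_inner_left,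
    real_inner_smul_left, inner_add_right, real_inner_smul_right,
    inner_sub_right (P.residual wb.1 wb.2.1) wb.2.2, real_inner_comm (P.residual wb.1 wb.2.1)]
  field_simp
  linarith

/-- Sum of the two subgradient inequalities tested at `v`. No KKT property of `v` is needed, which
lets the ergodic bound be tested against all points. -/
theorem gap_le (h : P.IsPADMMStep T₁ T₂ σ w wb) (hf₁ : IsProperClosedConvex P.f₁)
    (hf₂ : IsProperClosedConvex P.f₂) (hT₁ : T₁.IsPositive) (hT₂ : T₂.IsPositive) (hσ : 0 < σ)
    {v : Y × Z × X} (hv₁ : v.1 ∈ dom P.f₁) (hv₂ : v.2.1 ∈ dom P.f₂) :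
    ((P.f₁ wb.1).toReal + (P.f₂ wb.2.1).toReal + ⟪v.2.2, P.residual wb.1 wb.2.1⟫_ℝ) -
      ((P.f₁ v.1).toReal + (P.f₂ v.2.1).toReal + ⟪wb.2.2, P.residual v.1 v.2.1⟫_ℝ) ≤
      -P.proxForm T₁ T₂ σ (wb - w) (wb - v) := by
  have s₁ := h.subgradient₁ hf₁ hT₁
  have s₂ := h.subgradient₂ hf₂ hT₂
  have h₁ := (hf₁.mem_subdifferential_iff (hf₁.mem_dom_of_mem_subdifferential s₁)).1 s₁ _ hv₁
  have h₂ := (hf₂.mem_subdifferential_iff (hf₂.mem_dom_of_mem_subdifferential s₂)).1 s₂ _ hv₂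
  rw [h.proxForm_eq hT₁ hT₂ hσ]
  rw [← neg_sub wb.1, inner_neg_neg] at h₁
  rw [← neg_sub wb.2.1, inner_neg_neg] at h₂
  linarith

end IsPADMMStep

end COP

/-! ### Telescoping, Jensen's inequality and semi-norm estimates. -/

section Ergodic

theorem ergodicMean_mem {V : Type*} [AddCommGroup V] [Module ℝ V] {C : Set V} (hC : Convex ℝ C)
    {s : ℕ → V} (hs : ∀ k, s k ∈ C) (k : ℕ) : ergodicMean s k ∈ C := by
  have hk : (k : ℝ) + 1 ≠ 0 := by positivity
  rw [ergodicMean, Finset.smul_sum]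
  refine hC.sum_mem (fun _ _ => by positivity) ?_ fun t _ => hs t
  simp [hk]

theorem ergodicMean_add (a b : ℕ → ℝ) (k : ℕ) :
    ergodicMean (fun t => a t + b t) k = ergodicMean a k + ergodicMean b k := by
  simp [ergodicMean, Finset.sum_add_distrib, mul_add]

theorem ergodicMean_const (a : ℝ) (k : ℕ) : ergodicMean (fun _ => a) k = a := by
  have hk : (k : ℝ) + 1 ≠ 0 := by positivity
  simp [ergodicMean, hk]

theorem ergodicMean_le_of_telescope {a u : ℕ → ℝ} (h : ∀ t, a t ≤ u t - u (t + 1))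
    (hu : ∀ t, 0 ≤ u t) (k : ℕ) : ergodicMean a k ≤ u 0 * (1 / ((k : ℝ) + 1)) := by
  rw [ergodicMean, smul_eq_mul, mul_comm]
  gcongr
  calc _ ≤ ∑ t ∈ Finset.range (k + 1), (u t - u (t + 1)) := Finset.sum_le_sum fun t _ => h t
    _ = u 0 - u (k + 1) := Finset.sum_range_sub' u (k + 1)
    _ ≤ u 0 := sub_le_self _ (hu _)

/-- Jensen's inequality for ergodic means. -/
theorem IsProperClosedConvex.toReal_ergodicMean_le {E : Type*} [NormedAddCommGroup E]
    [InnerProductSpace ℝ E] {f : E → EReal} (hf : IsProperClosedConvex f) {s : ℕ → E}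
    (hs : ∀ k, s k ∈ dom f) (k : ℕ) : ergodicMean s k ∈ dom f ∧
      (f (ergodicMean s k)).toReal ≤ ergodicMean (fun t => (f (s t)).toReal) k := by
  have h := ergodicMean_mem hf.convex (s := fun t => (s t, (f (s t)).toReal))
    (fun t => by simp [hf.coe_toReal (hs t)]) k
  have e1 := ergodicMean_map (LinearMap.fst ℝ E ℝ) (fun t => (s t, (f (s t)).toReal)) k
  have e2 := ergodicMean_map (LinearMap.snd ℝ E ℝ) (fun t => (s t, (f (s t)).toReal)) k
  simp only [LinearMap.fst_apply, LinearMap.snd_apply] at e1 e2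
  rw [Set.mem_ofPred_eq, e1, e2] at h
  have hd : ergodicMean s k ∈ dom f := lt_of_le_of_lt h (EReal.coe_lt_top _)
  refine ⟨hd, ?_⟩
  rwa [← hf.coe_toReal hd, EReal.coe_le_coe_iff] at h

variable {V : Type*} [AddCommGroup V] [Module ℝ V]

theorem form_sub_self_le {m : V →ₗ[ℝ] V →ₗ[ℝ] ℝ} (hnonneg : ∀ a, 0 ≤ m a a) (a b : V) :
    m (a - b) (a - b) ≤ 2 * m a a + 2 * m b b := by
  have := hnonneg (a + b)
  simp only [map_add, map_sub, LinearMap.add_apply, LinearMap.sub_apply] at *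
  linarith

theorem neg_form_le {m : V →ₗ[ℝ] V →ₗ[ℝ] ℝ} (hsymm : ∀ a b, m a b = m b a)
    (hnonneg : ∀ a, 0 ≤ m a a) (a b : V) : -m a b ≤ (m a a + m b b) / 2 := by
  have := hnonneg (a + b)
  have := hsymm a b
  simp only [map_add, LinearMap.add_apply] at *
  linarith

theorem neg_inner_le_seminormSq {E : Type*} [NormedAddCommGroup E] [InnerProductSpace ℝ E]
    {T : E →ₗ[ℝ] E} (hT : T.IsPositive) (a b : E) :
    -⟪T a, b⟫_ℝ ≤ (seminormSq T a + seminormSq T b) / 2 := by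
  have h := seminormSq_nonneg hT (a + b)
  have e : ⟪b, T a⟫_ℝ = ⟪T a, b⟫_ℝ := real_inner_comm _ _
  have e' : ⟪a, T b⟫_ℝ = ⟪T a, b⟫_ℝ := (hT.isSymmetric a b).symm
  simp only [seminormSq, map_add, inner_add_left, inner_add_right, e, e'] at *
  linarith

end Ergodic

/-! ### KKT points: optimality, saddle points and separation by the semi-inner product. -/

namespace COP

variable {Y Z X : Type*}
  [NormedAddCommGroup Y] [InnerProductSpace ℝ Y] [FiniteDimensional ℝ Y]
  [NormedAddCommGroup Z] [InnerProductSpace ℝ Z] [FiniteDimensional ℝ Z]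
  [NormedAddCommGroup X] [InnerProductSpace ℝ X] [FiniteDimensional ℝ X]
  {P : COP Y Z X} {T₁ S₁ : Y →ₗ[ℝ] Y} {T₂ S₂ : Z →ₗ[ℝ] Z} {σ ρ : ℝ}

theorem IsKKT.isPrimalSolution {y : Y} {z : Z} {x : X} (h : P.IsKKT y z x)
    (hf₁ : IsProperClosedConvex P.f₁) (hf₂ : IsProperClosedConvex P.f₂) :
    P.IsPrimalSolution y z := by
  obtain ⟨hy, hz, hr⟩ := h
  have hyd := hf₁.mem_dom_of_mem_subdifferential hy
  have hzd := hf₂.mem_dom_of_mem_subdifferential hz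
  refine ⟨hyd, hzd, sub_eq_zero.1 hr, fun y' z' h' => ?_⟩
  by_cases hy' : y' ∈ dom P.f₁
  · by_cases hz' : z' ∈ dom P.f₂
    · have h1 := (hf₁.mem_subdifferential_iff hyd).1 hy y' hy'
      have h2 := (hf₂.mem_subdifferential_iff hzd).1 hz z' hz'
      have e : P.B₁ (y' - y) + P.B₂ (z' - z) = 0 := by
        rw [map_sub, map_sub, ← sub_eq_zero.2 (h'.trans (sub_eq_zero.1 hr).symm)]
        abel
      have e' := congrArg (fun a => ⟪x, a⟫_ℝ) e
      simp only [inner_add_right, inner_zero_right] at e'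
      rw [inner_neg_left, LinearMap.adjoint_inner_left] at h1 h2
      rw [← hf₁.coe_toReal hyd, ← hf₁.coe_toReal hy', ← hf₂.coe_toReal hzd, ← hf₂.coe_toReal hz']
      norm_cast
      linarith
    · rw [show P.f₂ z' = ⊤ from not_lt_top_iff.1 hz', EReal.add_top_of_ne_bot (hf₁.ne_bot _)]
      exact le_top
  · rw [show P.f₁ y' = ⊤ from not_lt_top_iff.1 hy', EReal.top_add_of_ne_bot (hf₂.ne_bot _)]
    exact le_top

theorem conjugate_eq_of_mem_subdifferential {E : Type*} [NormedAddCommGroup E]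
    [InnerProductSpace ℝ E] {f : E → EReal} (hf : IsProperClosedConvex f) {x v : E}
    (hv : v ∈ subdifferential f x) :
    conjugate f v = ((⟪v, x⟫_ℝ - (f x).toReal : ℝ) : EReal) := by
  have hx := hf.mem_dom_of_mem_subdifferential hv
  refine le_antisymm (iSup_le fun z => ?_) (le_iSup_of_le x ?_)
  · by_cases hz : z ∈ dom f
    · have h := (hf.mem_subdifferential_iff hx).1 hv z hz
      rw [← hf.coe_toReal hz]
      norm_cast
      rw [inner_sub_right] at h
      linarith
    · simp [show f z = ⊤ from not_lt_top_iff.1 hz]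
  · rw [← hf.coe_toReal hx]
    norm_cast

theorem le_conjugate {E : Type*} [NormedAddCommGroup E]
    [InnerProductSpace ℝ E] {f : E → EReal} (hf : IsProperClosedConvex f) {x : E}
    (hx : x ∈ dom f) (v : E) : ((⟪v, x⟫_ℝ - (f x).toReal : ℝ) : EReal) ≤ conjugate f v := by
  refine le_iSup_of_le x ?_
  rw [← hf.coe_toReal hx]
  norm_cast

theorem IsKKT.isDualSolution {y : Y} {z : Z} {x : X} (h : P.IsKKT y z x)
    (hf₁ : IsProperClosedConvex P.f₁) (hf₂ : IsProperClosedConvex P.f₂) :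
    P.IsDualSolution x := by
  obtain ⟨hy, hz, hr⟩ := h
  have hyd := hf₁.mem_dom_of_mem_subdifferential hy
  have hzd := hf₂.mem_dom_of_mem_subdifferential hz
  -- Fenchel–Young at the KKT pair bounds the dual objective at `x'` by the left side; feasibility
  -- of the pair makes this the primal value for every `x'`.
  have key : ∀ x' : X, ((-(⟪-P.B₁.adjoint x', y⟫_ℝ - (P.f₁ y).toReal) -
      (⟪-P.B₂.adjoint x', z⟫_ℝ - (P.f₂ z).toReal) - ⟪P.c, x'⟫_ℝ : ℝ) : EReal) =
      (((P.f₁ y).toReal + (P.f₂ z).toReal : ℝ) : EReal) := by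
    intro x'
    rw [EReal.coe_eq_coe_iff, inner_neg_left, inner_neg_left, LinearMap.adjoint_inner_left,
      LinearMap.adjoint_inner_left, ← sub_eq_zero.1 hr, inner_add_left, real_inner_comm x',
      real_inner_comm x']
    ring
  have hx : P.dualObjective x = (((P.f₁ y).toReal + (P.f₂ z).toReal : ℝ) : EReal) := by
    rw [← key x, dualObjective, conjugate_eq_of_mem_subdifferential hf₁ hy,
      conjugate_eq_of_mem_subdifferential hf₂ hz]
    norm_cast
  refine ⟨hx ▸ EReal.coe_ne_bot _, fun x' => ?_⟩
  rw [hx, ← key x', dualObjective]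
  push_cast only [EReal.coe_sub, EReal.coe_neg]
  refine EReal.sub_le_sub (EReal.sub_le_sub ?_ ?_) le_rfl
  · have := le_conjugate hf₁ hyd (-P.B₁.adjoint x')
    rw [EReal.coe_sub] at this
    exact EReal.neg_le_neg_iff.2 this
  · have := le_conjugate hf₂ hzd (-P.B₂.adjoint x')
    rwa [EReal.coe_sub] at this

/-- Saddle points of the Lagrangian solve the KKT system. -/
theorem isKKT_of_saddle (hf₁ : IsProperClosedConvex P.f₁) (hf₂ : IsProperClosedConvex P.f₂)
    {a : Y × Z × X} (h : ∀ v : Y × Z × X, v.1 ∈ dom P.f₁ → v.2.1 ∈ dom P.f₂ →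
      ∀ α β : ℝ, (α : EReal) < P.f₁ a.1 → (β : EReal) < P.f₂ a.2.1 →
        α + β + ⟪v.2.2, P.residual a.1 a.2.1⟫_ℝ ≤
          (P.f₁ v.1).toReal + (P.f₂ v.2.1).toReal + ⟪a.2.2, P.residual v.1 v.2.1⟫_ℝ) :
    P.IsKKT a.1 a.2.1 a.2.2 := by
  obtain ⟨y, z, x⟩ := a
  simp only [Prod.forall] at h ⊢
  obtain ⟨y0, hy0⟩ := hf₁.dom_nonempty
  obtain ⟨z0, hz0⟩ := hf₂.dom_nonempty
  obtain ⟨α0, -, hα0⟩ := EReal.lt_iff_exists_real_btwn.1 (bot_lt_iff_ne_bot.2 (hf₁.ne_bot y))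
  obtain ⟨β0, -, hβ0⟩ := EReal.lt_iff_exists_real_btwn.1 (bot_lt_iff_ne_bot.2 (hf₂.ne_bot z))
  -- Were the value `⊤`, `α` could be any real; it is chosen to violate the inequality by 1. The
  -- multiplier 0 removes the residual term.
  have hy : y ∈ dom P.f₁ := by
    by_contra hy
    have := h y0 z0 0 hy0 hz0 ((P.f₁ y0).toReal + (P.f₂ z0).toReal + ⟪x, P.residual y0 z0⟫_ℝ
      - β0 + 1) β0 (by rw [show P.f₁ y = ⊤ from not_lt_top_iff.1 hy]; exact EReal.coe_lt_top _) hβ0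
    rw [inner_zero_left] at this
    linarith
  have hz : z ∈ dom P.f₂ := by
    by_contra hz
    have := h y0 z0 0 hy0 hz0 α0 ((P.f₁ y0).toReal + (P.f₂ z0).toReal + ⟪x, P.residual y0 z0⟫_ℝ
      - α0 + 1) hα0 (by rw [show P.f₂ z = ⊤ from not_lt_top_iff.1 hz]; exact EReal.coe_lt_top _)
    rw [inner_zero_left] at this
    linarith
  have hs : ∀ y' z' x', y' ∈ dom P.f₁ → z' ∈ dom P.f₂ →
      (P.f₁ y).toReal + (P.f₂ z).toReal + ⟪x', P.residual y z⟫_ℝ ≤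
        (P.f₁ y').toReal + (P.f₂ z').toReal + ⟪x, P.residual y' z'⟫_ℝ := by
    intro y' z' x' hy' hz'
    refine le_of_forall_pos_le_add fun ε hε => ?_
    have := h y' z' x' hy' hz' ((P.f₁ y).toReal - ε / 2) ((P.f₂ z).toReal - ε / 2)
      (by rw [← hf₁.coe_toReal hy, EReal.toReal_coe]; exact_mod_cast by linarith)
      (by rw [← hf₂.coe_toReal hz, EReal.toReal_coe]; exact_mod_cast by linarith)
    linarith
  have hr : P.residual y z = 0 := by
    -- Moving the multiplier along the residual r gives ‖r‖² ≤ 0.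
    have := hs y z (x + P.residual y z) hy hz
    rw [inner_add_left] at this
    refine norm_eq_zero.1 (pow_eq_zero_iff two_ne_zero |>.1 (le_antisymm ?_ (sq_nonneg _)))
    rw [real_inner_self_eq_norm_sq] at this
    linarith
  refine ⟨(hf₁.mem_subdifferential_iff hy).2 fun y' hy' => ?_,
    (hf₂.mem_subdifferential_iff hz).2 fun z' hz' => ?_, hr⟩
  · have := hs y' z x hy' hz
    rw [show P.residual y' z = P.B₁ (y' - y) + P.residual y z by
      simp only [residual, map_sub]; abel, hr, add_zero, inner_zero_right] at this
    rw [inner_neg_left, LinearMap.adjoint_inner_left]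
    linarith
  · have := hs y z' x hy hz'
    rw [show P.residual y z' = P.B₂ (z' - z) + P.residual y z by
      simp only [residual, map_sub]; abel, hr, add_zero, inner_zero_right] at this
    rw [inner_neg_left, LinearMap.adjoint_inner_left]
    linarith

/-- Write dy, dz, dx for the differences. Feasibility gives B₂dz = -B₁dy, so monotonicity bounds the
two Σ-terms by -⟨dx, B₁dy⟩ and ⟨dx, B₁dy⟩: all three vanish. The null semi-norm gives B₁dy = -σ⁻¹dx,
hence dx = 0, and positive definiteness removes dy and dz. -/
theorem IsKKT.eq_of_proxForm_eq_zero {v v' : Y × Z × X} (h : P.IsKKT v.1 v.2.1 v.2.2)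
    (h' : P.IsKKT v'.1 v'.2.1 v'.2.2)
    (hf₁ : IsProperClosedConvex P.f₁) (hf₂ : IsProperClosedConvex P.f₂)
    (hS₁ : IsConvexityOperator P.f₁ S₁) (hS₂ : IsConvexityOperator P.f₂ S₂)
    (hT₁ : T₁.IsPositive) (hT₂ : T₂.IsPositive)
    (hpd₁ : IsPosDef (S₁ + P.B₁.adjoint ∘ₗ P.B₁ + T₁))
    (hpd₂ : IsPosDef (S₂ + P.B₂.adjoint ∘ₗ P.B₂ + T₂)) (hσ : 0 < σ)
    (h0 : P.proxForm T₁ T₂ σ (v - v') (v - v') = 0) : v = v' := by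
  obtain ⟨y, z, x⟩ := v
  obtain ⟨y', z', x'⟩ := v'
  obtain ⟨hy, hz, hr⟩ := h
  obtain ⟨hy', hz', hr'⟩ := h'
  dsimp only at hy hz hr hy' hz' hr'
  have m₁ := hS₁.strongly_monotone hf₁ hy hy'
  have m₂ := hS₂.strongly_monotone hf₂ hz hz'
  rw [neg_sub_neg, ← map_sub, LinearMap.adjoint_inner_left, ← neg_sub x x', inner_neg_left]
    at m₁ m₂
  have e : P.B₂ (z - z') = -P.B₁ (y - y') := by
    rw [eq_neg_iff_add_eq_zero, map_sub, map_sub, ← sub_eq_zero.2 (hr.trans hr'.symm)]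
    abel
  rw [e, inner_neg_right] at m₂
  rw [proxForm_self] at h0
  simp only [Prod.mk_sub_mk] at h0
  have a1 := seminormSq_nonneg hT₁ (y - y')
  have a2 := seminormSq_nonneg hT₂ (z - z')
  have a3 := seminormSq_nonneg hS₁.1 (y - y')
  have a4 := seminormSq_nonneg hS₂.1 (z - z')
  have a5 : 0 ≤ σ * ‖P.B₁ (y - y') + σ⁻¹ • (x - x')‖ ^ 2 := by positivity
  have b5 : P.B₁ (y - y') + σ⁻¹ • (x - x') = 0 := by
    have : σ * ‖P.B₁ (y - y') + σ⁻¹ • (x - x')‖ ^ 2 = 0 := by linarith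
    simpa [hσ.ne'] using this
  have hx : x - x' = 0 := by
    have h1 : P.B₁ (y - y') = -(σ⁻¹ • (x - x')) := eq_neg_of_add_eq_zero_left b5
    have h2 : ⟪x - x', P.B₁ (y - y')⟫_ℝ = 0 := by linarith
    rw [h1, inner_neg_right, real_inner_smul_right, neg_eq_zero] at h2
    simpa [hσ.ne'] using h2
  rw [hx, smul_zero, add_zero] at b5
  rw [b5, neg_zero] at e
  have hyy : y - y' = 0 := by
    by_contra hne
    have := hpd₁.2 _ hne
    simp only [LinearMap.add_apply, LinearMap.comp_apply, inner_add_right, b5, map_zero,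
      inner_zero_right] at this
    simp only [seminormSq] at *
    linarith
  have hzz : z - z' = 0 := by
    by_contra hne
    have := hpd₂.2 _ hne
    simp only [LinearMap.add_apply, LinearMap.comp_apply, inner_add_right, e, map_zero,
      inner_zero_right] at this
    simp only [seminormSq] at *
    linarith
  rw [sub_eq_zero.1 hx, sub_eq_zero.1 hyy, sub_eq_zero.1 hzz]

/-! ### Fejér inequality and boundedness of a single step. -/

namespace IsPADMMStep

variable {w wb : Y × Z × X}

theorem inner_add_seminormSq_le₂ (h : P.IsPADMMStep T₁ T₂ σ w wb)
    (hf₂ : IsProperClosedConvex P.f₂) (hS₂ : IsConvexityOperator P.f₂ S₂) (hT₂ : T₂.IsPositive)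
    {v : Y × Z × X} (hv : P.IsKKT v.1 v.2.1 v.2.2) :
    ⟪wb.2.2 - v.2.2, P.B₂ (wb.2.1 - v.2.1)⟫_ℝ + ⟪T₂ (wb.2.1 - w.2.1), wb.2.1 - v.2.1⟫_ℝ +
      seminormSq S₂ (wb.2.1 - v.2.1) ≤ 0 := by
  have := hS₂.strongly_monotone hf₂ (h.subgradient₂ hf₂ hT₂) hv.2.1
  rw [neg_sub_neg, inner_sub_left, inner_add_left, LinearMap.adjoint_inner_left,
    LinearMap.adjoint_inner_left] at this
  rw [inner_sub_left]
  linarith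

theorem inner_add_seminormSq_le₁ (h : P.IsPADMMStep T₁ T₂ σ w wb)
    (hf₁ : IsProperClosedConvex P.f₁) (hS₁ : IsConvexityOperator P.f₁ S₁) (hT₁ : T₁.IsPositive)
    {v : Y × Z × X} (hv : P.IsKKT v.1 v.2.1 v.2.2) :
    seminormSq S₁ (wb.1 - v.1) ≤ ⟪v.2.2, P.B₁ (wb.1 - v.1)⟫_ℝ -
      ⟪P.B₁.adjoint (wb.2.2 + σ • P.residual wb.1 wb.2.1) + T₁ (wb.1 - w.1), wb.1 - v.1⟫_ℝ := by
  have := hS₁.strongly_monotone hf₁ (h.subgradient₁ hf₁ hT₁) hv.1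
  rwa [neg_sub_neg, inner_sub_left, LinearMap.adjoint_inner_left] at this

/-- Strong monotonicity against a KKT point. Nonnegativity of the left side gives Fejér
monotonicity; the Σ-terms themselves are needed for boundedness. -/
theorem seminormSq_add_le (h : P.IsPADMMStep T₁ T₂ σ w wb)
    (hf₁ : IsProperClosedConvex P.f₁) (hf₂ : IsProperClosedConvex P.f₂)
    (hS₁ : IsConvexityOperator P.f₁ S₁) (hS₂ : IsConvexityOperator P.f₂ S₂)
    (hT₁ : T₁.IsPositive) (hT₂ : T₂.IsPositive) (hσ : 0 < σ)
    {v : Y × Z × X} (hv : P.IsKKT v.1 v.2.1 v.2.2) :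
    seminormSq S₁ (wb.1 - v.1) + seminormSq S₂ (wb.2.1 - v.2.1) ≤
      -P.proxForm T₁ T₂ σ (wb - w) (wb - v) := by
  have m₁ := h.inner_add_seminormSq_le₁ hf₁ hS₁ hT₁ hv
  have m₂ := h.inner_add_seminormSq_le₂ hf₂ hS₂ hT₂ hv
  have hr : P.residual v.1 v.2.1 = 0 := hv.2.2
  have e : P.residual wb.1 wb.2.1 = P.B₁ (wb.1 - v.1) + P.B₂ (wb.2.1 - v.2.1) := by
    rw [← sub_zero (P.residual wb.1 wb.2.1), ← hr]
    simp only [residual, map_sub]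
    abel
  have e' := congrArg (fun a => ⟪v.2.2, a⟫_ℝ) e
  simp only [inner_add_right] at e'
  rw [h.proxForm_eq hT₁ hT₂ hσ, hr, inner_zero_right, inner_add_left (P.B₂.adjoint _),
    LinearMap.adjoint_inner_left P.B₂, e']
  rw [inner_sub_left] at m₂
  linarith

/-- The semi-norm alone bounds only T-terms and B₁y + σ⁻¹x. The z-inclusion bounds ⟨p, b₂⟩ from
above, and p = σg + σb₂ with `g` bounded then bounds `p`. From this follow `b₂`, `b₁`, and the
primal errors by positive definiteness. -/
theorem exists_norm_le (hf₁ : IsProperClosedConvex P.f₁) (hf₂ : IsProperClosedConvex P.f₂)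
    (hS₁ : IsConvexityOperator P.f₁ S₁) (hS₂ : IsConvexityOperator P.f₂ S₂)
    (hT₁ : T₁.IsPositive) (hT₂ : T₂.IsPositive)
    (hpd₁ : IsPosDef (S₁ + P.B₁.adjoint ∘ₗ P.B₁ + T₁))
    (hpd₂ : IsPosDef (S₂ + P.B₂.adjoint ∘ₗ P.B₂ + T₂)) (hσ : 0 < σ)
    {v : Y × Z × X} (hv : P.IsKKT v.1 v.2.1 v.2.2) (D : ℝ) :
    ∃ C, ∀ w wb, P.IsPADMMStep T₁ T₂ σ w wb → P.proxForm T₁ T₂ σ (w - v) (w - v) ≤ D →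
      P.proxForm T₁ T₂ σ (wb - v) (wb - v) ≤ D → ‖wb‖ ≤ C := by
  obtain ⟨m₁, hm₁, hle₁⟩ := exists_pos_mul_norm_sq_le hpd₁.2
  obtain ⟨m₂, hm₂, hle₂⟩ := exists_pos_mul_norm_sq_le hpd₂.2
  -- The bound 2D + 2D on the squared semi-norm of wb - w.
  set K := 4 * D with hK
  refine ⟨√((2 * K + 8 * K / σ) / m₁) + √((2 * K + 8 * K / σ) / m₂) + √(3 * σ * K) + ‖v‖,
    fun w wb h hw hwb => ?_⟩
  have hnn := proxForm_self_nonneg (P := P) hT₁ hT₂ hσ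
  have hD : 0 ≤ D := (hnn _).trans hw
  have hwbw : P.proxForm T₁ T₂ σ (wb - w) (wb - w) ≤ K := by
    have := form_sub_self_le hnn (wb - v) (w - v)
    rw [sub_sub_sub_cancel_right] at this
    linarith
  have hS := h.seminormSq_add_le hf₁ hf₂ hS₁ hS₂ hT₁ hT₂ hσ hv
  have hcross := neg_form_le (proxForm_symm hT₁ hT₂) hnn (wb - w) (wb - v)
  have hT := neg_inner_le_seminormSq hT₂ (wb.2.1 - w.2.1) (wb.2.1 - v.2.1)
  have hB := h.inner_add_seminormSq_le₂ hf₂ hS₂ hT₂ hv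
  have hr : P.residual v.1 v.2.1 = 0 := hv.2.2
  set p := wb.2.2 - v.2.2 with hp
  set b₁ := P.B₁ (wb.1 - v.1) with hb₁
  set b₂ := P.B₂ (wb.2.1 - v.2.1) with hb₂
  set g := P.B₁ (w.1 - v.1) + σ⁻¹ • (w.2.2 - v.2.2) with hg
  rw [proxForm_self] at hw hwb hwbw hcross
  rw [proxForm_self] at hcross
  simp only [Prod.fst_sub, Prod.snd_sub, ← hg, ← hb₁, ← hp] at hw hwb hwbw hcross
  have s1 := seminormSq_nonneg hS₁.1 (wb.1 - v.1)
  have s2 := seminormSq_nonneg hS₂.1 (wb.2.1 - v.2.1)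
  have t1 := seminormSq_nonneg hT₁ (wb.1 - v.1)
  have t2 := seminormSq_nonneg hT₂ (wb.2.1 - v.2.1)
  have t3 := seminormSq_nonneg hT₁ (wb.1 - w.1)
  have t4 := seminormSq_nonneg hT₂ (wb.2.1 - w.2.1)
  have t5 := seminormSq_nonneg hT₁ (w.1 - v.1)
  have t6 := seminormSq_nonneg hT₂ (w.2.1 - v.2.1)
  have u1 : 0 ≤ σ * ‖b₁ + σ⁻¹ • p‖ ^ 2 := by positivity
  have u2 : 0 ≤ σ * ‖P.B₁ (wb.1 - w.1) + σ⁻¹ • (wb.2.2 - w.2.2)‖ ^ 2 := by positivity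
  have hpg : p = σ • g + σ • b₂ := by
    have : P.residual w.1 wb.2.1 = P.B₁ (w.1 - v.1) + b₂ := by
      rw [← sub_zero (P.residual w.1 wb.2.1), ← hr, hb₂]
      simp only [residual, map_sub]
      abel
    rw [hp, h.2.1, this, hg, smul_add σ _ (σ⁻¹ • _), smul_inv_smul₀ hσ.ne', smul_add]
    abel
  have hgn : σ * ‖g‖ ^ 2 ≤ D := by linarith
  have hpb : ⟪p, b₂⟫_ℝ ≤ K := by linarith
  have hpn : ‖p‖ ^ 2 ≤ 3 * σ * K := by
    -- Young's inequality on the first term absorbs half of ‖p‖², leaving ‖p‖² ≤ σD + 2σK.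
    have e : ‖p‖ ^ 2 = σ * ⟪p, g⟫_ℝ + σ * ⟪p, b₂⟫_ℝ := by
      rw [← real_inner_self_eq_norm_sq]
      nth_rewrite 2 [hpg]
      rw [inner_add_right, real_inner_smul_right, real_inner_smul_right]
    have h1 := norm_sub_sq_real p (σ • g)
    rw [norm_smul, mul_pow, Real.norm_of_nonneg hσ.le, real_inner_smul_right] at h1
    have h2 := mul_le_mul_of_nonneg_left hpb hσ.le
    have h3 := mul_le_mul_of_nonneg_left hgn hσ.le
    have h4 := sq_nonneg ‖p - σ • g‖
    have h5 : 0 ≤ σ * D := by positivity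
    rw [hK] at h2 ⊢
    linarith
  have par : ∀ a b : X, ‖a - b‖ ^ 2 ≤ 2 * ‖a‖ ^ 2 + 2 * ‖b‖ ^ 2 := fun a b => by
    have h1 := norm_sub_sq_real a b
    have h2 := norm_add_sq_real a b
    have h3 := sq_nonneg ‖a + b‖
    linarith
  have hb₂n : ‖b₂‖ ^ 2 ≤ 8 * K / σ := by
    have h1 := par p (σ • g)
    rw [show p - σ • g = σ • b₂ by rw [hpg]; abel, norm_smul, norm_smul, mul_pow, mul_pow,
      Real.norm_of_nonneg hσ.le] at h1
    rw [le_div_iff₀ hσ]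
    refine le_of_mul_le_mul_left ?_ hσ
    have h3 := mul_le_mul_of_nonneg_left hgn hσ.le
    have h5 : 0 ≤ σ * D := by positivity
    rw [hK] at hpn ⊢
    linarith
  have hb₁n : ‖b₁‖ ^ 2 ≤ 8 * K / σ := by
    have h1 := par (σ • (b₁ + σ⁻¹ • p)) p
    rw [smul_add, smul_inv_smul₀ hσ.ne', add_sub_cancel_right, ← smul_inv_smul₀ hσ.ne' p,
      ← smul_add, smul_inv_smul₀ hσ.ne' p, norm_smul, norm_smul, mul_pow, mul_pow,
      Real.norm_of_nonneg hσ.le] at h1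
    rw [le_div_iff₀ hσ]
    refine le_of_mul_le_mul_left ?_ hσ
    have h2 : σ * ‖b₁ + σ⁻¹ • p‖ ^ 2 ≤ D := by linarith
    have h3 := mul_le_mul_of_nonneg_left h2 hσ.le
    have h5 : 0 ≤ σ * D := by positivity
    rw [hK] at hpn ⊢
    linarith
  have hyn : ‖wb.1 - v.1‖ ≤ √((2 * K + 8 * K / σ) / m₁) := by
    refine Real.le_sqrt_of_sq_le ?_
    rw [le_div_iff₀ hm₁, mul_comm]
    refine (hle₁ _).trans ?_
    simp only [LinearMap.add_apply, LinearMap.comp_apply, inner_add_right,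
      LinearMap.adjoint_inner_right, real_inner_self_eq_norm_sq, ← hb₁]
    simp only [seminormSq] at *
    linarith
  have hzn : ‖wb.2.1 - v.2.1‖ ≤ √((2 * K + 8 * K / σ) / m₂) := by
    refine Real.le_sqrt_of_sq_le ?_
    rw [le_div_iff₀ hm₂, mul_comm]
    refine (hle₂ _).trans ?_
    simp only [LinearMap.add_apply, LinearMap.comp_apply, inner_add_right,
      LinearMap.adjoint_inner_right, real_inner_self_eq_norm_sq, ← hb₂]
    simp only [seminormSq] at *
    linarith
  have hxn : ‖p‖ ≤ √(3 * σ * K) := Real.le_sqrt_of_sq_le hpn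
  have hsub : ‖wb - v‖ ≤ √((2 * K + 8 * K / σ) / m₁) + √((2 * K + 8 * K / σ) / m₂) +
      √(3 * σ * K) := by
    have n1 := Real.sqrt_nonneg ((2 * K + 8 * K / σ) / m₁)
    have n2 := Real.sqrt_nonneg ((2 * K + 8 * K / σ) / m₂)
    have n3 := Real.sqrt_nonneg (3 * σ * K)
    refine max_le (hyn.trans (by linarith)) (max_le (hzn.trans (by linarith))
      (hxn.trans (by linarith)))
  calc ‖wb‖ = ‖(wb - v) + v‖ := by rw [sub_add_cancel]
    _ ≤ ‖wb - v‖ + ‖v‖ := norm_add_le _ _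
    _ ≤ _ := by linarith

end IsPADMMStep

/-! ### The whole sequence: monotonicity, boundedness, ergodic gap and cluster points. -/

namespace IsPADMM

variable {w0 : Y × Z × X} {w wb : ℕ → Y × Z × X}

omit [FiniteDimensional ℝ Y] [FiniteDimensional ℝ Z] [FiniteDimensional ℝ X] in
theorem proxForm_decrease (h : P.IsPADMM T₁ T₂ σ ρ w0 w wb) (hT₁ : T₁.IsPositive)
    (hT₂ : T₂.IsPositive) (hσ : 0 < σ) (hρ : ρ ∈ Set.Ioc (0 : ℝ) 2) (v : Y × Z × X) (k : ℕ) :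
    2 * ρ * -P.proxForm T₁ T₂ σ (wb k - w k) (wb k - v) ≤
      P.proxForm T₁ T₂ σ (w k - v) (w k - v) -
        P.proxForm T₁ T₂ σ (w (k + 1) - v) (w (k + 1) - v) := by
  rw [(h.2 k).2, relaxed_step_form _ (proxForm_symm hT₁ hT₂)]
  have := mul_nonneg (mul_nonneg hρ.1.le (sub_nonneg.2 hρ.2))
    (proxForm_self_nonneg (P := P) hT₁ hT₂ hσ (wb k - w k))
  linarith

theorem antitone_proxForm (h : P.IsPADMM T₁ T₂ σ ρ w0 w wb)
    (hf₁ : IsProperClosedConvex P.f₁) (hf₂ : IsProperClosedConvex P.f₂)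
    (hS₁ : IsConvexityOperator P.f₁ S₁) (hS₂ : IsConvexityOperator P.f₂ S₂)
    (hT₁ : T₁.IsPositive) (hT₂ : T₂.IsPositive) (hσ : 0 < σ) (hρ : ρ ∈ Set.Ioc (0 : ℝ) 2)
    {v : Y × Z × X} (hv : P.IsKKT v.1 v.2.1 v.2.2) :
    Antitone fun k => P.proxForm T₁ T₂ σ (w k - v) (w k - v) := by
  refine antitone_nat_of_succ_le fun k => ?_
  have h1 := h.proxForm_decrease hT₁ hT₂ hσ hρ v k
  have h2 := (h.2 k).1.seminormSq_add_le hf₁ hf₂ hS₁ hS₂ hT₁ hT₂ hσ hv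
  have h3 := seminormSq_nonneg hS₁.1 ((wb k).1 - v.1)
  have h4 := seminormSq_nonneg hS₂.1 ((wb k).2.1 - v.2.1)
  have h5 := mul_nonneg (mul_nonneg zero_le_two hρ.1.le) ((add_nonneg h3 h4).trans h2)
  linarith

theorem exists_norm_le (h : P.IsPADMM T₁ T₂ σ ρ w0 w wb)
    (hf₁ : IsProperClosedConvex P.f₁) (hf₂ : IsProperClosedConvex P.f₂)
    (hS₁ : IsConvexityOperator P.f₁ S₁) (hS₂ : IsConvexityOperator P.f₂ S₂)
    (hT₁ : T₁.IsPositive) (hT₂ : T₂.IsPositive)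
    (hpd₁ : IsPosDef (S₁ + P.B₁.adjoint ∘ₗ P.B₁ + T₁))
    (hpd₂ : IsPosDef (S₂ + P.B₂.adjoint ∘ₗ P.B₂ + T₂)) (hσ : 0 < σ)
    (hρ : ρ ∈ Set.Ioc (0 : ℝ) 2) (hKKT : ∃ (y : Y) (z : Z) (x : X), P.IsKKT y z x) :
    ∃ C, ∀ k, ‖wb k‖ ≤ C := by
  obtain ⟨y, z, x, hv⟩ := hKKT
  set v : Y × Z × X := (y, z, x)
  have hanti := h.antitone_proxForm hf₁ hf₂ hS₁ hS₂ hT₁ hT₂ hσ hρ (v := v) hv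
  have hnn := proxForm_self_nonneg (P := P) hT₁ hT₂ hσ
  set D := P.proxForm T₁ T₂ σ (w 0 - v) (w 0 - v)
  have hD : 0 ≤ D := hnn _
  -- `D` serves `w`; 4D/ρ² serves `wb`, because ρ(wb - v) is the next error minus (1 - ρ) times the
  -- current one and |1 - ρ| ≤ 1.
  obtain ⟨C, hC⟩ := IsPADMMStep.exists_norm_le hf₁ hf₂ hS₁ hS₂ hT₁ hT₂ hpd₁ hpd₂ hσ (v := v) hv
    (D + 4 * D / ρ ^ 2)
  have hw : ∀ k, P.proxForm T₁ T₂ σ (w k - v) (w k - v) ≤ D := fun k => hanti k.zero_le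
  refine ⟨C, fun k => hC _ _ (h.2 k).1 ((hw k).trans (le_add_of_nonneg_right (by positivity)))
    (le_trans ?_ (le_add_of_nonneg_left hD))⟩
  have h1 := form_sub_self_le hnn (w (k + 1) - v) ((1 - ρ) • (w k - v))
  have e : w (k + 1) - v - (1 - ρ) • (w k - v) = ρ • (wb k - v) := by
    rw [(h.2 k).2]
    module
  simp only [e, map_smul, LinearMap.smul_apply, smul_eq_mul] at h1
  have h2 : (1 - ρ) * ((1 - ρ) * P.proxForm T₁ T₂ σ (w k - v) (w k - v)) ≤ 1 * D := by
    rw [← mul_assoc]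
    refine mul_le_mul ?_ (hw k) (hnn _) zero_le_one
    nlinarith [hρ.1, hρ.2]
  rw [le_div_iff₀ (pow_pos hρ.1 2)]
  have h3 := hw (k + 1)
  linarith

theorem lagrangian_gap_ergodicMean_le (h : P.IsPADMM T₁ T₂ σ ρ w0 w wb)
    (hf₁ : IsProperClosedConvex P.f₁) (hf₂ : IsProperClosedConvex P.f₂)
    (hT₁ : T₁.IsPositive) (hT₂ : T₂.IsPositive) (hσ : 0 < σ) (hρ : ρ ∈ Set.Ioc (0 : ℝ) 2)
    {v : Y × Z × X} (hv₁ : v.1 ∈ dom P.f₁) (hv₂ : v.2.1 ∈ dom P.f₂) :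
    ∃ D : ℝ, ∀ k, (ergodicMean wb k).1 ∈ dom P.f₁ ∧ (ergodicMean wb k).2.1 ∈ dom P.f₂ ∧
      (P.f₁ (ergodicMean wb k).1).toReal + (P.f₂ (ergodicMean wb k).2.1).toReal +
        ⟪v.2.2, P.residual (ergodicMean wb k).1 (ergodicMean wb k).2.1⟫_ℝ -
        ((P.f₁ v.1).toReal + (P.f₂ v.2.1).toReal +
          ⟪(ergodicMean wb k).2.2, P.residual v.1 v.2.1⟫_ℝ) ≤ D * (1 / ((k : ℝ) + 1)) := by
  -- For fixed `v` the coupling part of the gap is affine in the iterate, so it commutes with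
  -- averaging; only `f₁` and `f₂` need Jensen.
  let ℓ : Y × Z × X →ₗ[ℝ] ℝ :=
    (innerₛₗ ℝ v.2.2) ∘ₗ (P.B₁ ∘ₗ LinearMap.fst ℝ Y (Z × X) +
      P.B₂ ∘ₗ LinearMap.fst ℝ Z X ∘ₗ LinearMap.snd ℝ Y (Z × X)) -
    (innerₛₗ ℝ (P.residual v.1 v.2.1)) ∘ₗ LinearMap.snd ℝ Z X ∘ₗ LinearMap.snd ℝ Y (Z × X)
  have hℓ : ∀ a : Y × Z × X, ⟪v.2.2, P.residual a.1 a.2.1⟫_ℝ - ⟪a.2.2, P.residual v.1 v.2.1⟫_ℝ =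
      ℓ a - ⟪v.2.2, P.c⟫_ℝ := fun a => by
    simp only [ℓ, LinearMap.sub_apply, LinearMap.comp_apply, LinearMap.add_apply,
      LinearMap.fst_apply, LinearMap.snd_apply, innerₛₗ_apply_apply,
      real_inner_comm (P.residual v.1 v.2.1)]
    rw [residual, inner_sub_right]
    ring
  set κ := -⟪v.2.2, P.c⟫_ℝ - (P.f₁ v.1).toReal - (P.f₂ v.2.1).toReal with hκ
  have hd₁ : ∀ t, (wb t).1 ∈ dom P.f₁ := fun t =>
    hf₁.mem_dom_of_mem_subdifferential ((h.2 t).1.subgradient₁ hf₁ hT₁)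
  have hd₂ : ∀ t, (wb t).2.1 ∈ dom P.f₂ := fun t =>
    hf₂.mem_dom_of_mem_subdifferential ((h.2 t).1.subgradient₂ hf₂ hT₂)
  have hstep : ∀ t, (P.f₁ (wb t).1).toReal + (P.f₂ (wb t).2.1).toReal + ℓ (wb t) + κ ≤
      P.proxForm T₁ T₂ σ (w t - v) (w t - v) / (2 * ρ) -
        P.proxForm T₁ T₂ σ (w (t + 1) - v) (w (t + 1) - v) / (2 * ρ) := fun t => by
    have hρ2 : 0 < 2 * ρ := mul_pos two_pos hρ.1
    have h1 := h.proxForm_decrease hT₁ hT₂ hσ hρ v t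
    have h2 := (h.2 t).1.gap_le hf₁ hf₂ hT₁ hT₂ hσ hv₁ hv₂
    rw [← sub_div, le_div_iff₀ hρ2, mul_comm]
    refine (mul_le_mul_of_nonneg_left ?_ hρ2.le).trans h1
    have := hℓ (wb t)
    linarith
  refine ⟨P.proxForm T₁ T₂ σ (w 0 - v) (w 0 - v) / (2 * ρ), fun k => ?_⟩
  have hmean := ergodicMean_le_of_telescope hstep (fun t => div_nonneg
    (proxForm_self_nonneg hT₁ hT₂ hσ _) (mul_pos two_pos hρ.1).le) k
  rw [ergodicMean_add, ergodicMean_add, ergodicMean_add, ergodicMean_const,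
    ← ergodicMean_map ℓ] at hmean
  have j₁ := hf₁.toReal_ergodicMean_le hd₁ k
  have j₂ := hf₂.toReal_ergodicMean_le hd₂ k
  have e₁ := ergodicMean_map (LinearMap.fst ℝ Y (Z × X)) wb k
  have e₂ := ergodicMean_map (LinearMap.fst ℝ Z X ∘ₗ LinearMap.snd ℝ Y (Z × X)) wb k
  simp only [LinearMap.comp_apply, LinearMap.fst_apply, LinearMap.snd_apply] at e₁ e₂
  rw [← e₁] at j₁
  rw [← e₂] at j₂
  refine ⟨j₁.1, j₂.1, ?_⟩
  have := hℓ (ergodicMean wb k)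
  linarith [j₁.2, j₂.2]

theorem isKKT_of_cluster (h : P.IsPADMM T₁ T₂ σ ρ w0 w wb)
    (hf₁ : IsProperClosedConvex P.f₁) (hf₂ : IsProperClosedConvex P.f₂)
    (hT₁ : T₁.IsPositive) (hT₂ : T₂.IsPositive) (hσ : 0 < σ) (hρ : ρ ∈ Set.Ioc (0 : ℝ) 2)
    {a : Y × Z × X} {φ : ℕ → ℕ} (hφ : Tendsto φ atTop atTop)
    (ha : Tendsto (fun k => ergodicMean wb (φ k)) atTop (𝓝 a)) :
    P.IsKKT a.1 a.2.1 a.2.2 := by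
  refine isKKT_of_saddle hf₁ hf₂ fun v hv₁ hv₂ α β hα hβ => ?_
  obtain ⟨D, hD⟩ := h.lagrangian_gap_ergodicMean_le hf₁ hf₂ hT₁ hT₂ hσ hρ hv₁ hv₂
  have hB₁ := LinearMap.continuous_of_finiteDimensional P.B₁
  have hB₂ := LinearMap.continuous_of_finiteDimensional P.B₂
  have hc : Continuous fun u : Y × Z × X => α + β + ⟪v.2.2, P.residual u.1 u.2.1⟫_ℝ -
      ((P.f₁ v.1).toReal + (P.f₂ v.2.1).toReal + ⟪u.2.2, P.residual v.1 v.2.1⟫_ℝ) := by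
    unfold residual
    fun_prop
  -- Lower semicontinuity enters through real minorants, since the values at `a` are not yet known
  -- to be finite.
  have hα' : ∀ᶠ k in atTop, (α : EReal) < P.f₁ (ergodicMean wb (φ k)).1 :=
    ((continuous_fst.tendsto a).comp ha).eventually (hf₁.closed a.1 α hα)
  have hβ' : ∀ᶠ k in atTop, (β : EReal) < P.f₂ (ergodicMean wb (φ k)).2.1 :=
    (((continuous_fst.comp continuous_snd).tendsto a).comp ha).eventually (hf₂.closed a.2.1 β hβ)
  have hlim : Tendsto (fun k => D * (1 / ((φ k : ℝ) + 1))) atTop (𝓝 (D * 0)) :=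
    ((tendsto_one_div_add_atTop_nhds_zero_nat (𝕜 := ℝ)).comp hφ).const_mul D
  have hle := le_of_tendsto_of_tendsto ((hc.tendsto a).comp ha) hlim (by
    filter_upwards [hα', hβ'] with k hk₁ hk₂
    obtain ⟨d₁, d₂, hgap⟩ := hD (φ k)
    rw [← hf₁.coe_toReal d₁, EReal.coe_lt_coe_iff] at hk₁
    rw [← hf₂.coe_toReal d₂, EReal.coe_lt_coe_iff] at hk₂
    simp only [Function.comp_apply]
    linarith)
  linarith

end IsPADMM

end COP

end ErgodicPADMM

theorem corollary1
    {Y Z X : Type*}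
    [NormedAddCommGroup Y] [InnerProductSpace ℝ Y] [FiniteDimensional ℝ Y]
    [NormedAddCommGroup Z] [InnerProductSpace ℝ Z] [FiniteDimensional ℝ Z]
    [NormedAddCommGroup X] [InnerProductSpace ℝ X] [FiniteDimensional ℝ X]
    (P : ErgodicPADMM.COP Y Z X)
    (hf₁ : ErgodicPADMM.IsProperClosedConvex P.f₁)
    (hf₂ : ErgodicPADMM.IsProperClosedConvex P.f₂)
    (hKKT : ∃ (y : Y) (z : Z) (x : X), P.IsKKT y z x)
    (S₁ : Y →ₗ[ℝ] Y) (S₂ : Z →ₗ[ℝ] Z)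
    (hS₁ : ErgodicPADMM.IsConvexityOperator P.f₁ S₁)
    (hS₂ : ErgodicPADMM.IsConvexityOperator P.f₂ S₂)
    (T₁ : Y →ₗ[ℝ] Y) (T₂ : Z →ₗ[ℝ] Z) (hT₁ : T₁.IsPositive) (hT₂ : T₂.IsPositive)
    (hpd₁ : ErgodicPADMM.IsPosDef (S₁ + P.B₁.adjoint ∘ₗ P.B₁ + T₁))
    (hpd₂ : ErgodicPADMM.IsPosDef (S₂ + P.B₂.adjoint ∘ₗ P.B₂ + T₂))
    (σ ρ : ℝ) (hσ : 0 < σ) (hρ : ρ ∈ Set.Ioc (0 : ℝ) 2)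
    (w0 : Y × Z × X) (hy0 : w0.1 ∈ ErgodicPADMM.dom P.f₁) (hz0 : w0.2.1 ∈ ErgodicPADMM.dom P.f₂) :
    (∃! s : (ℕ → Y × Z × X) × (ℕ → Y × Z × X), P.IsPADMM T₁ T₂ σ ρ w0 s.1 s.2) ∧
    ∀ w wb : ℕ → Y × Z × X, P.IsPADMM T₁ T₂ σ ρ w0 w wb →
      ∃ (y : Y) (z : Z) (x : X),
        Tendsto (ErgodicPADMM.ergodicMean wb) atTop (𝓝 (y, z, x)) ∧
        P.IsPrimalSolution y z ∧ P.IsDualSolution x := by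
  refine ⟨ErgodicPADMM.COP.existsUnique_isPADMM
    (P.existsUnique_isPADMMStep hf₁ hf₂ hKKT hS₁ hS₂ hT₁ hT₂ hpd₁ hpd₂ hσ) w0, fun w wb h => ?_⟩
  obtain ⟨C, hC⟩ := h.exists_norm_le hf₁ hf₂ hS₁ hS₂ hT₁ hT₂ hpd₁ hpd₂ hσ hρ hKKT
  obtain ⟨⟨y, z, x⟩, hv, hlim⟩ := ErgodicPADMM.exists_tendsto_ergodicMean
    (P.proxForm T₁ T₂ σ) (ErgodicPADMM.COP.proxForm_symm hT₁ hT₂)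
    (ErgodicPADMM.COP.proxForm_self_nonneg hT₁ hT₂ hσ) hρ.1
    (F := {v | P.IsKKT v.1 v.2.1 v.2.2}) (fun k => (h.2 k).2)
    (fun v hv => h.antitone_proxForm hf₁ hf₂ hS₁ hS₂ hT₁ hT₂ hσ hρ hv) hC
    (fun v φ hφ hv => h.isKKT_of_cluster hf₁ hf₂ hT₁ hT₂ hσ hρ hφ hv)
    (fun v hv v' hv' h0 =>
      hv.eq_of_proxForm_eq_zero hv' hf₁ hf₂ hS₁ hS₂ hT₁ hT₂ hpd₁ hpd₂ hσ h0)
  exact ⟨y, z, x, hlim, hv.isPrimalSolution hf₁ hf₂, hv.isDualSolution hf₁ hf₂⟩
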